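/- A partition of $[n]$ ($n\ge 0$) is identified with its canonical sequential form $\pi=\pi_1\pi_2\cdots\pi_n$, where $\pi_j=i$ if $j$ lies in the $i$-th block when the blocks are ordered by their minima; for $n=0$ this is the empty partition. A partition $\pi$ contains a partition $\tau$ if the word $\pi$ has a subsequence order-isomorphic to the word $\tau$, and otherwise avoids it. It is non-crossing if it avoids $1212$. For partitions $\sigma,\tau$, let $\sigma[\tau]$ be the word $\sigma$ followed by the word obtained from $\tau$ by adding $k$ to every letter, where $k$ is the number of distinct letters of $\sigma$; and let $\sigma[\rho][\tau]=(\sigma[\rho])[\tau]$, and so on. A partition is connected if it is not of the form $\sigma[\tau]$ with $\sigma,\tau$ nonempty; every partition $\pi$ can be written uniquely as $\sigma_1[\sigma_2]\cdots[\sigma_m]$ with all $\sigma_i$ nonempty and connected, and $\sigma_1,\dots,\sigma_m$ are the components of $\pi$. Two non-crossing partitions $\sigma,\tau$ are cc-equivalent if there is a bijection from the set of non-crossing partitions avoiding $\sigma$ to the set of non-crossing partitions avoiding $\tau$ that preserves both the size and the number of components. Theorem. If $\sigma$ and $\tau$ are (possibly empty) non-crossing partitions, and $\rho$ and $\rho'$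 are two cc-equivalent non-crossing partitions, then $\sigma[\rho][\tau]$ and $\sigma[\rho'][\tau]$ are cc-equivalent. -/

import Mathlib

/-- The largest letter of a word (`0` for the empty word). -/
def maxLetter (w : List ℕ) : ℕ := w.foldr max 0

/-- `w` is a restricted growth function, i.e. the canonical sequential form of a set partition of
`[w.length]`: every letter is a positive integer and exceeds the maximum of the letters before it
by at most one.  (Hence the first letter is `1`, and the letters used are exactly `1, …, k` with
`k = maxLetter w`, see `IsCanonical.mem_iff`.)  The word `w₁ w₂ ⋯ wₙ` represents the partition of
`[n]` in which `i` and `j` lie in the same block iff `wᵢ = wⱼ`. -/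
def IsCanonical (w : List ℕ) : Prop :=
  ∀ (u : List ℕ) (a : ℕ) (v : List ℕ), w = u ++ a :: v → 1 ≤ a ∧ a ≤ maxLetter u + 1

/-- A set partition of `[n]`, for some `n ≥ 0`, given by its canonical sequential form. -/
@[ext]
structure SetPartition where
  /-- the canonical sequential form -/
  word : List ℕ
  canonical : IsCanonical word

theorem maxLetter_append (u v : List ℕ) :
    maxLetter (u ++ v) = max (maxLetter u) (maxLetter v) := by
  induction u with
  | nil => simp [maxLetter]
  | cons a u ih =>
    simp only [maxLetter, List.cons_append, List.foldr_cons] at ih ⊢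
    rw [ih, max_assoc]

theorem maxLetter_map_add (k : ℕ) (u : List ℕ) :
    max k (maxLetter (u.map (· + k))) = maxLetter u + k := by
  induction u with
  | nil => simp [maxLetter]
  | cons a u ih =>
    simp only [maxLetter, List.map_cons, List.foldr_cons] at ih ⊢
    omega

theorem IsCanonical.prefix {u v : List ℕ} (h : IsCanonical (u ++ v)) : IsCanonical u := by
  rintro p a q rfl
  exact h p a (q ++ v) (by simp)

theorem IsCanonical.mem_iff {w : List ℕ} (h : IsCanonical w) (b : ℕ) :
    b ∈ w ↔ 1 ≤ b ∧ b ≤ maxLetter w := by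
  induction w using List.reverseRecOn with
  | nil => simp [maxLetter]; omega
  | append_singleton w a ih =>
    have h1 := h w a [] rfl
    have h2 := ih h.prefix
    have h3 : maxLetter [a] = a := by simp [maxLetter]
    rw [List.mem_append, h2, maxLetter_append, h3, List.mem_singleton]
    omega

namespace SetPartition

/-- The size `n` of a partition of `[n]`. -/
def size (π : SetPartition) : ℕ := π.word.length

/-- The number of blocks, i.e. the number of distinct symbols of the canonical form. -/
def numBlocks (π : SetPartition) : ℕ := π.word.toFinset.card

theorem numBlocks_eq_maxLetter (π : SetPartition) : π.numBlocks = maxLetter π.word := by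
  have : π.word.toFinset = Finset.Icc 1 (maxLetter π.word) := by
    ext b
    simp [π.canonical.mem_iff b]
  simp [numBlocks, this]

/-- The empty partition, the unique partition of `[0] = ∅`. -/
def empty : SetPartition := ⟨[], by intro u a v h; simp at h⟩

/-- The partition `1212`. -/
def p1212 : SetPartition where
  word := [1, 2, 1, 2]
  canonical := by
    intro u a v h
    rcases u with _ | ⟨_, _ | ⟨_, _ | ⟨_, _ | ⟨_, u⟩⟩⟩⟩ <;> simp [maxLetter] at h ⊢ <;> omega

/-- `π.Contains τ`: the canonical form of `π` has a subsequence that is order-isomorphic to the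
canonical form of `τ`. -/
def Contains (π τ : SetPartition) : Prop :=
  ∃ f : Fin τ.word.length → Fin π.word.length, StrictMono f ∧
    ∀ i j, π.word.get (f i) < π.word.get (f j) ↔ τ.word.get i < τ.word.get j

/-- `π` avoids the pattern `τ`. -/
def Avoids (π τ : SetPartition) : Prop := ¬ π.Contains τ

/-- A partition is non-crossing if it avoids `1212`. -/
def NonCrossing (π : SetPartition) : Prop := π.Avoids p1212

/-- The partition `σ[τ]`: the word `σ` followed by `τ + k`, where `k` is the number of distinct
symbols of `σ`. Accordingly `σ[ρ][τ]` is `(σ.bracket ρ).bracket τ`. -/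
def bracket (σ τ : SetPartition) : SetPartition where
  word := σ.word ++ τ.word.map (· + σ.numBlocks)
  canonical := by
    intro u a v h
    rcases List.append_eq_append_iff.mp h with ⟨p, hu, hp⟩ | ⟨p, hσ, hp⟩
    · obtain ⟨q, r, hτ, hq, hr⟩ := List.map_eq_append_iff.mp hp
      obtain ⟨b, s, rfl, rfl, rfl⟩ := List.map_eq_cons_iff.mp hr
      have h1 := τ.canonical q b s hτ
      have h2 := maxLetter_map_add σ.numBlocks q
      rw [hu, maxLetter_append, ← hq, ← numBlocks_eq_maxLetter, h2]
      omega
    · rcases p with _ | ⟨c, p⟩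
      · obtain ⟨b, s, hτ, rfl, rfl⟩ := List.map_eq_cons_iff.mp hp.symm
        have h1 := τ.canonical [] b s hτ
        have h0 : maxLetter [] = 0 := rfl
        have h2 : maxLetter u = σ.numBlocks := by simp [numBlocks_eq_maxLetter, hσ]
        omega
      · obtain ⟨rfl, -⟩ := List.cons_eq_cons.mp hp
        exact σ.canonical u a p hσ

/-- A partition is connected if it is not of the form `σ[τ]` with `σ` and `τ` nonempty. -/
def Connected (π : SetPartition) : Prop :=
  ¬ ∃ σ τ : SetPartition, σ ≠ empty ∧ τ ≠ empty ∧ π = σ.bracket τ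

/-- The partition `σ₁[σ₂][σ₃]⋯[σₘ]`. -/
def concat (L : List SetPartition) : SetPartition := L.foldl bracket empty

/-- `L` is the sequence of components of `π`: its members are nonempty connected partitions
`σ₁, …, σₘ` with `π = σ₁[σ₂]⋯[σₘ]`. -/
def IsComponents (π : SetPartition) (L : List SetPartition) : Prop :=
  (∀ c ∈ L, c ≠ empty ∧ c.Connected) ∧ π = concat L

theorem numBlocks_bracket (σ τ : SetPartition) :
    (σ.bracket τ).numBlocks = σ.numBlocks + τ.numBlocks := by
  rw [numBlocks_eq_maxLetter (σ.bracket τ), numBlocks_eq_maxLetter τ]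
  simp only [bracket]
  rw [maxLetter_append, ← numBlocks_eq_maxLetter, maxLetter_map_add, add_comm]

theorem bracket_assoc (σ τ υ : SetPartition) :
    (σ.bracket τ).bracket υ = σ.bracket (τ.bracket υ) := by
  ext1
  have h := numBlocks_bracket σ τ
  simp only [bracket] at h ⊢
  simp only [h, List.map_append, List.map_map, List.append_assoc, Function.comp_def]
  congr 3
  funext x
  omega

theorem empty_bracket (σ : SetPartition) : empty.bracket σ = σ := by
  ext1
  simp [bracket, empty, numBlocks]

theorem bracket_empty (σ : SetPartition) : σ.bracket empty = σ := by
  ext1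
  simp [bracket, empty]

theorem foldl_bracket (σ : SetPartition) (L : List SetPartition) :
    L.foldl bracket σ = σ.bracket (concat L) := by
  induction L generalizing σ with
  | nil => simp [concat, bracket_empty]
  | cons c L ih => rw [concat, List.foldl_cons, List.foldl_cons, ih, ih (empty.bracket c),
      empty_bracket, bracket_assoc]

theorem concat_cons (c : SetPartition) (L : List SetPartition) :
    concat (c :: L) = c.bracket (concat L) := by
  rw [concat, List.foldl_cons, foldl_bracket, empty_bracket]

theorem concat_append (L M : List SetPartition) :
    concat (L ++ M) = (concat L).bracket (concat M) := by
  rw [concat, List.foldl_append, foldl_bracket]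
  rfl

theorem size_eq_zero {σ : SetPartition} : σ.size = 0 ↔ σ = empty := by
  rw [SetPartition.ext_iff]
  exact List.length_eq_zero_iff

theorem size_bracket (σ τ : SetPartition) : (σ.bracket τ).size = σ.size + τ.size := by
  simp [size, bracket]

theorem bracket_left_injective (σ : SetPartition) {τ υ : SetPartition}
    (h : σ.bracket τ = σ.bracket υ) : τ = υ := by
  ext1
  have h := congrArg word h
  exact List.map_injective_iff.mpr (add_left_injective σ.numBlocks) (List.append_cancel_left h)

/-- If `σ[τ] = σ'[τ']` and `σ'` is connected and `σ` is nonempty, then `σ` is not shorter than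
`σ'`. -/
theorem size_le_of_bracket_eq {σ τ σ' τ' : SetPartition} (h : σ.bracket τ = σ'.bracket τ')
    (hσ : σ ≠ empty) (hσ' : σ'.Connected) : σ'.size ≤ σ.size := by
  by_contra! hlt
  apply hσ'
  have hw : σ.word ++ τ.word.map (· + σ.numBlocks) = σ'.word ++ τ'.word.map (· + σ'.numBlocks) :=
    congrArg word h
  rcases List.append_eq_append_iff.mp hw with ⟨p, hu, hp⟩ | ⟨p, hσ1, hp⟩
  · obtain ⟨q, r, hτ, hq, hr⟩ := List.map_eq_append_iff.mp hp
    have hc := τ.canonical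
    rw [hτ] at hc
    refine ⟨σ, ⟨q, hc.prefix⟩, hσ, ?_, ?_⟩
    · rintro he
      have : q = [] := congrArg word he
      subst this
      have hp0 : p = [] := by simpa using hq.symm
      simp [size, hu, hp0] at hlt
    · ext1
      rw [hu, ← hq]
      rfl
  · simp [size, hσ1] at hlt

/-- Every partition has a unique sequence of components. -/
theorem existsUnique_isComponents (π : SetPartition) : ∃! L, π.IsComponents L := by
  apply existsUnique_of_exists_of_unique
  · induction hn : π.size using Nat.strong_induction_on generalizing π with
    | _ n ih =>
      by_cases h0 : π = empty
      · exact ⟨[], by simp, h0⟩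
      by_cases hc : π.Connected
      · exact ⟨[π], by simpa using ⟨h0, hc⟩, by simp [concat, empty_bracket]⟩
      · obtain ⟨σ, τ, hσ, hτ, rfl⟩ := not_not.mp hc
        rw [size_bracket] at hn
        have h1 := mt size_eq_zero.mp hσ
        have h2 := mt size_eq_zero.mp hτ
        obtain ⟨L, hL, hL'⟩ := ih σ.size (by omega) σ rfl
        obtain ⟨M, hM, hM'⟩ := ih τ.size (by omega) τ rfl
        refine ⟨L ++ M, ?_, ?_⟩
        · intro c hcm
          rcases List.mem_append.mp hcm with h | h
          exacts [hL c h, hM c h]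
        · rw [concat_append, ← hL', ← hM']
  · rintro L M ⟨hL, hπ⟩ ⟨hM, hπ'⟩
    rw [hπ] at hπ'
    clear hπ
    induction L generalizing M with
    | nil =>
      rcases M with _ | ⟨d, M⟩
      · rfl
      · have h := congrArg size hπ'
        rw [concat_cons, size_bracket] at h
        have h1 := mt size_eq_zero.mp (hM d (by simp)).1
        have h2 : (concat []).size = 0 := rfl
        omega
    | cons c L ih =>
      rcases M with _ | ⟨d, M⟩
      · have h := congrArg size hπ'
        rw [concat_cons, size_bracket] at h
        have h1 := mt size_eq_zero.mp (hL c (by simp)).1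
        have h2 : (concat []).size = 0 := rfl
        omega
      · rw [concat_cons, concat_cons] at hπ'
        have hc := hL c (by simp)
        have hd := hM d (by simp)
        have hs : c.word.length = d.word.length := le_antisymm
          (size_le_of_bracket_eq hπ'.symm hd.1 hc.2) (size_le_of_bracket_eq hπ' hc.1 hd.2)
        have hcd : c = d := by
          ext1
          exact (List.append_inj (congrArg word hπ') hs).1
        subst hcd
        rw [ih M (fun x hx => hL x (List.mem_cons_of_mem c hx))
          (fun x hx => hM x (List.mem_cons_of_mem c hx)) (bracket_left_injective c hπ')]

/-- The sequence of components of `π`. -/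
noncomputable def components (π : SetPartition) : List SetPartition :=
  (existsUnique_isComponents π).choose

theorem isComponents_iff {π : SetPartition} {L : List SetPartition} :
    π.IsComponents L ↔ L = π.components := by
  refine ⟨fun h => (existsUnique_isComponents π).choose_spec.2 L h, ?_⟩
  rintro rfl
  exact (existsUnique_isComponents π).choose_spec.1

/-- Two non-crossing partitions `σ` and `τ` are cc-equivalent if there is a bijection from the
`(1212, σ)`-avoiding partitions to the `(1212, τ)`-avoiding partitions that preserves the size and
the number of components. -/
def CCEquivalent (σ τ : SetPartition) : Prop :=
  σ.NonCrossing ∧ τ.NonCrossing ∧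
    ∃ f : {π : SetPartition // π.Avoids p1212 ∧ π.Avoids σ} ≃
        {π : SetPartition // π.Avoids p1212 ∧ π.Avoids τ},
      ∀ π, (f π).1.size = π.1.size ∧ (f π).1.components.length = π.1.components.length

end SetPartition

/-!
# Height sequences

A non-crossing partition is encoded by the sequence whose `i`-th entry is the number of components
of its restriction to `[i]`.  All sequences and words below are written in reverse, so that the
head of a list is its last entry.
-/

/-! A non-crossing word is built letter by letter. The next letter is either new or repeats the
least letter of a current component, as repeating any other letter would create `1212`. Repeating
the least letter of the i-th component merges it with all later ones and leaves i components; a new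
letter adds one component. So non-crossing partitions of `[n]` correspond to sequences of `n`
positive heights that grow by at most one per step, and the last height is the number of components.

Let `S` continue an initial part `P`. A letter written by `S` is either fresh, i.e. larger than all
letters of `P`, or the least letter of a component of `P`, hence at most the last letter of `P`.
Cutting an occurrence of `σ[ρ]` where the copy of `σ` ends therefore leaves only fresh letters for
`ρ`. Thus `σ[ρ]` occurs iff there is a cut with `σ` in `P` and `ρ` in the fresh part of `S`
(`IsHeightSeq.occurs_append_iff`).

For `ρ[τ]`, cut off the shortest end whose fresh part contains `τ`. Avoidance means that the
remaining start avoids `ρ`. The given bijection is applied to this start; it keeps the final height,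
so the same end still fits and has the same fresh part (`Converts.modify_start`).

For `σ[ρ]`, take the shortest start containing `σ`. Avoidance means that the fresh part of the rest
avoids `ρ`, and the bijection is applied to this fresh part. Old letters interact with it only
through its components, so a new fresh part with equally many components fits into the same skeleton
in exactly one way (`exists_sameSkeleton`, `SameSkeleton.unique`), which gives
`Converts.modify_end`.

In both cases the cut can be recognised after the replacement, so the inverse bijection undoes it.
Preservation of the number of components is what makes the pieces fit. -/

/-- The last height of a reversed sequence of heights `S` that continues a sequence of height
`c`. -/
def topHeight (c : ℕ) (S : List ℕ) : ℕ := S.headD c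

/-- The least height reached by `S`, starting from height `c`. -/
def minHeight (c : ℕ) : List ℕ → ℕ
  | [] => c
  | x :: S => min x (minHeight c S)

/-- `S` is a (reversed) sequence of heights continuing a sequence of height `c`: all heights are
positive, and the height grows by at most one in each step. -/
def IsHeightSeq (c : ℕ) : List ℕ → Prop
  | [] => True
  | x :: S => IsHeightSeq c S ∧ 1 ≤ x ∧ x ≤ topHeight c S + 1

@[simp] theorem topHeight_nil (c : ℕ) : topHeight c [] = c := rfl

@[simp] theorem topHeight_cons (c x : ℕ) (S : List ℕ) : topHeight c (x :: S) = x := rfl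

@[simp] theorem minHeight_nil (c : ℕ) : minHeight c [] = c := rfl

@[simp] theorem minHeight_cons (c x : ℕ) (S : List ℕ) :
    minHeight c (x :: S) = min x (minHeight c S) := rfl

@[simp] theorem isHeightSeq_nil (c : ℕ) : IsHeightSeq c [] := trivial

@[simp] theorem isHeightSeq_cons (c x : ℕ) (S : List ℕ) :
    IsHeightSeq c (x :: S) ↔ IsHeightSeq c S ∧ 1 ≤ x ∧ x ≤ topHeight c S + 1 := Iff.rfl

theorem topHeight_append (c : ℕ) (S P : List ℕ) :
    topHeight c (S ++ P) = topHeight (topHeight c P) S := by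
  cases S <;> rfl

theorem isHeightSeq_append {c : ℕ} {S P : List ℕ} :
    IsHeightSeq c (S ++ P) ↔ IsHeightSeq c P ∧ IsHeightSeq (topHeight c P) S := by
  induction S with
  | nil => simp
  | cons x S ih => simp [ih, topHeight_append, and_assoc]

theorem minHeight_le_topHeight (c : ℕ) (S : List ℕ) : minHeight c S ≤ topHeight c S := by
  cases S <;> simp

theorem minHeight_le (c : ℕ) (S : List ℕ) : minHeight c S ≤ c := by
  induction S with
  | nil => simp
  | cons x S ih => simp [ih]

theorem topHeight_map_append (B : List ℕ) (c : ℕ) (S : List ℕ) :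
    topHeight c (B.map (· + topHeight c S) ++ S) = topHeight 0 B + topHeight c S := by
  cases B <;> simp

theorem IsHeightSeq.minHeight_map_append {B : List ℕ} (hB : IsHeightSeq 0 B) (c : ℕ)
    (S : List ℕ) : minHeight c (B.map (· + topHeight c S) ++ S) = minHeight c S := by
  have := minHeight_le_topHeight c S
  induction B with
  | nil => simp
  | cons b B ih =>
    simp only [List.map_cons, List.cons_append, minHeight_cons, ih hB.1]
    omega

theorem IsHeightSeq.map_append {B : List ℕ} (hB : IsHeightSeq 0 B) {c : ℕ} {S : List ℕ}
    (hS : IsHeightSeq c S) : IsHeightSeq c (B.map (· + topHeight c S) ++ S) := by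
  induction B with
  | nil => simpa
  | cons b B ih =>
    obtain ⟨h, h1, h2⟩ := hB
    simp only [List.map_cons, List.cons_append, isHeightSeq_cons, topHeight_map_append]
    exact ⟨ih h, by omega, by omega⟩

/-! ### Fresh parts of continuations -/

/-- The height sequence of the restriction of a partition to the letters that are new in the
continuation `S` of a sequence of height `c`. -/
def freshPart (c : ℕ) : List ℕ → List ℕ
  | [] => []
  | x :: S => if x ≤ minHeight c S then freshPart c S
      else (topHeight 0 (freshPart c S) + x - topHeight c S) :: freshPart c S

@[simp] theorem freshPart_nil (c : ℕ) : freshPart c [] = [] := rfl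

theorem freshPart_cons_old {c x : ℕ} {S : List ℕ} (h : x ≤ minHeight c S) :
    freshPart c (x :: S) = freshPart c S := by
  simp [freshPart, h]

theorem freshPart_cons_fresh {c x : ℕ} {S : List ℕ} (h : minHeight c S < x) :
    freshPart c (x :: S) =
      (topHeight 0 (freshPart c S) + x - topHeight c S) :: freshPart c S := by
  simp [freshPart, h]

/-- Components beyond the least height reached consist of fresh letters only. This keeps the
truncated subtraction in `freshPart` harmless: every entry it produces is positive. -/
theorem topHeight_le_freshPart (c : ℕ) (S : List ℕ) :
    topHeight c S ≤ topHeight 0 (freshPart c S) + minHeight c S := by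
  induction S with
  | nil => simp
  | cons x S ih =>
    rcases le_or_gt x (minHeight c S) with h | h
    · simp [freshPart_cons_old h, h]
    · simp only [freshPart_cons_fresh h, topHeight_cons, minHeight_cons]
      omega

theorem IsHeightSeq.freshPart {c : ℕ} {S : List ℕ} (hS : IsHeightSeq c S) :
    IsHeightSeq 0 (freshPart c S) := by
  induction S with
  | nil => simp
  | cons x S ih =>
    obtain ⟨h0, h1, h2⟩ := hS
    have := topHeight_le_freshPart c S
    rcases le_or_gt x (minHeight c S) with h | h
    · rw [freshPart_cons_old h]
      exact ih h0
    · rw [freshPart_cons_fresh h, isHeightSeq_cons]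
      exact ⟨ih h0, by omega, by omega⟩

theorem IsHeightSeq.freshPart_map_append {B : List ℕ} (hB : IsHeightSeq 0 B) (c : ℕ)
    (S : List ℕ) : _root_.freshPart c (B.map (· + topHeight c S) ++ S) =
      B.map (· + topHeight 0 (_root_.freshPart c S)) ++ _root_.freshPart c S := by
  have := minHeight_le_topHeight c S
  induction B with
  | nil => simp
  | cons b B ih =>
    obtain ⟨h, h1, h2⟩ := hB
    simp only [List.map_cons, List.cons_append]
    rw [freshPart_cons_fresh, ih h, topHeight_map_append, topHeight_map_append]
    · congr 1
      omega
    · rw [h.minHeight_map_append]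
      omega

theorem minHeight_zero (S : List ℕ) : minHeight 0 S = 0 :=
  Nat.le_zero.mp (minHeight_le 0 S)

/-- Go back to the last moment at height `x - 1`. It exists because the height has been below `x`
and rises by at most one per step; all later heights are at least `x`. -/
theorem IsHeightSeq.exists_eq_map_append {c x : ℕ} {S : List ℕ} (hS : IsHeightSeq c S)
    (h1 : minHeight c S < x) (h2 : x ≤ topHeight c S + 1) :
    ∃ B S₁, S = B.map (· + (x - 1)) ++ S₁ ∧ IsHeightSeq 0 B ∧ topHeight c S₁ = x - 1 ∧
      IsHeightSeq c S₁ := by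
  induction S with
  | nil =>
    simp only [minHeight_nil, topHeight_nil] at h1 h2
    exact ⟨[], [], by simp, by simp, by simp; omega, by simp⟩
  | cons y S ih =>
    rcases lt_or_ge y x with h | h
    · simp only [topHeight_cons] at h2
      exact ⟨[], y :: S, by simp, by simp, by simp; omega, hS⟩
    · obtain ⟨hS, hy1, hy2⟩ := hS
      simp only [minHeight_cons] at h1
      obtain ⟨B, S₁, rfl, hB, hS₁, hS₁'⟩ := ih hS (by omega) (by omega)
      refine ⟨(y - (x - 1)) :: B, S₁, ?_, ⟨hB, by omega, ?_⟩, hS₁, hS₁'⟩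
      · simp only [List.map_cons, List.cons_append]
        congr 1
        omega
      · rw [← hS₁, topHeight_map_append] at hy2
        omega

/-- A height that is not an old one ends a block of consecutive heights which is the shifted
height sequence of a connected partition. -/
theorem IsHeightSeq.exists_component {c x : ℕ} {S : List ℕ} (hS : IsHeightSeq c (x :: S))
    (h : minHeight c S < x) :
    ∃ B S₁, x :: S = B.map (· + topHeight c S₁) ++ S₁ ∧ IsHeightSeq 0 B ∧ topHeight 0 B = 1 ∧
      IsHeightSeq c S₁ := by
  obtain ⟨hS, hx1, hx2⟩ := hS
  obtain ⟨B, S₁, rfl, hB, hS₁, hS₁'⟩ := hS.exists_eq_map_append h hx2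
  -- The entry `x` lies one above the base height `x - 1`, hence becomes the final `1` of the block.
  refine ⟨1 :: B, S₁, ?_, ⟨hB, le_rfl, by omega⟩, rfl, hS₁'⟩
  rw [hS₁, List.map_cons, List.cons_append]
  congr 1
  omega

/-! ### Skeletons: exchanging the components of the fresh part -/

/-- Two continuations of a sequence of height `c` that differ only by a replacement of the
components of their fresh parts. -/
inductive SameSkeleton (c : ℕ) : List ℕ → List ℕ → Prop
  | nil : SameSkeleton c [] []
  | old {x : ℕ} {S S' : List ℕ} (h : SameSkeleton c S S') (h1 : 1 ≤ x) (hx : x ≤ minHeight c S) :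
      SameSkeleton c (x :: S) (x :: S')
  | component {B B' S S' : List ℕ} (h : SameSkeleton c S S') (hB : IsHeightSeq 0 B)
      (hB' : IsHeightSeq 0 B') (h1 : topHeight 0 B = 1) (h1' : topHeight 0 B' = 1) :
      SameSkeleton c (B.map (· + topHeight c S) ++ S) (B'.map (· + topHeight c S') ++ S')

namespace SameSkeleton

variable {c : ℕ} {S S' : List ℕ}

theorem minHeight_eq (h : SameSkeleton c S S') : minHeight c S = minHeight c S' := by
  induction h with
  | nil => rfl
  | old h h1 hx ih => simp [ih]
  | component h hB hB' h1 h1' ih => rw [hB.minHeight_map_append, hB'.minHeight_map_append, ih]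

theorem topHeight_eq (h : SameSkeleton c S S') : topHeight c S = topHeight c S' := by
  induction h with
  | nil => rfl
  | old h h1 hx ih => rfl
  | component h hB hB' h1 h1' ih => rw [topHeight_map_append, topHeight_map_append, ih, h1, h1']

theorem symm (h : SameSkeleton c S S') : SameSkeleton c S' S := by
  induction h with
  | nil => exact nil
  | old h h1 hx ih => exact ih.old h1 (h.minHeight_eq ▸ hx)
  | component h hB hB' h1 h1' ih => exact ih.component hB' hB h1' h1

theorem isHeightSeq (h : SameSkeleton c S S') : IsHeightSeq c S' := by
  induction h with
  | nil => simp
  | @old x S S' h h1 hx ih =>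
    have := minHeight_le_topHeight c S
    have := h.topHeight_eq
    exact ⟨ih, h1, by omega⟩
  | component h hB hB' h1 h1' ih => exact hB'.map_append ih

theorem length_add (h : SameSkeleton c S S') :
    S.length + (freshPart c S').length = S'.length + (freshPart c S).length := by
  induction h with
  | nil => rfl
  | old h h1 hx ih =>
    rw [freshPart_cons_old hx, freshPart_cons_old (h.minHeight_eq ▸ hx)]
    simp only [List.length_cons]
    omega
  | component h hB hB' h1 h1' ih =>
    rw [hB.freshPart_map_append, hB'.freshPart_map_append]
    simp only [List.length_append, List.length_map]
    omega

end SameSkeleton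

/-- Parse `S` from its end: an old entry is copied, while a block forming a component is exchanged
for the last component of `U`. Equal numbers of components ensure that both are used up together. -/
theorem exists_sameSkeleton {c : ℕ} {S U : List ℕ} (hS : IsHeightSeq c S) (hU : IsHeightSeq 0 U)
    (h : topHeight 0 U = topHeight 0 (freshPart c S)) :
    ∃ S', SameSkeleton c S S' ∧ freshPart c S' = U := by
  induction hn : S.length using Nat.strong_induction_on generalizing S U with
  | _ n ih =>
    rcases S with _ | ⟨x, S⟩
    · rcases U with _ | ⟨y, U⟩
      · exact ⟨[], .nil, rfl⟩
      · have := hU.2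
        simp only [topHeight_cons, freshPart_nil, topHeight_nil] at h
        omega
    · rcases le_or_gt x (minHeight c S) with hx | hx
      · rw [freshPart_cons_old hx] at h
        obtain ⟨S', h1, h2⟩ := ih S.length (by simp [← hn]) hS.1 hU h rfl
        exact ⟨x :: S', h1.old hS.2.1 hx, by rw [freshPart_cons_old (h1.minHeight_eq ▸ hx), h2]⟩
      · obtain ⟨B, S₁, he, hB, hB1, hS₁⟩ := hS.exists_component hx
        have hlt : S₁.length < n := by
          have := congrArg List.length he
          have : B ≠ [] := by rintro rfl; simp at hB1
          have := List.length_pos_iff.mpr this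
          simp only [List.length_append, List.length_map] at *
          omega
        rw [he] at h ⊢
        rw [hB.freshPart_map_append, topHeight_map_append] at h
        rcases U with _ | ⟨y, U⟩
        · simp only [topHeight_nil] at h
          omega
        · obtain ⟨B', U₁, he', hB', hB1', hU₁⟩ := hU.exists_component
            (by rw [minHeight_zero]; exact hU.2.1)
          rw [he', topHeight_map_append] at h
          obtain ⟨S', h1, h2⟩ := ih _ hlt hS₁ hU₁ (by omega) rfl
          refine ⟨_, h1.component hB hB' hB1 hB1', ?_⟩
          rw [hB'.freshPart_map_append, h2, he']

/-- The remainder has height one less than the whole, and all entries of the shifted block exceed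
that height. So the block ends, read backwards, at the first return to it. -/
theorem map_append_inj {c : ℕ} {B B' S S' : List ℕ} (hB : IsHeightSeq 0 B) (hB' : IsHeightSeq 0 B')
    (h1 : topHeight 0 B = 1) (h1' : topHeight 0 B' = 1)
    (h : B.map (· + topHeight c S) ++ S = B'.map (· + topHeight c S') ++ S') :
    B = B' ∧ S = S' := by
  have ht : topHeight c S = topHeight c S' := by
    have := congrArg (topHeight c) h
    rw [topHeight_map_append, topHeight_map_append] at this
    omega
  rw [← ht] at h
  clear h1 h1'
  induction B generalizing B' with
  | nil =>
    rcases B' with _ | ⟨b, B'⟩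
    · exact ⟨rfl, by simpa using h⟩
    · have := hB'.2
      have := congrArg (topHeight c) h
      simp at this
      omega
  | cons b B ih =>
    rcases B' with _ | ⟨b', B'⟩
    · have := hB.2
      have := congrArg (topHeight c) h
      simp at this
      omega
    · simp only [List.map_cons, List.cons_append, List.cons.injEq] at h
      obtain ⟨rfl, rfl⟩ := ih hB.1 hB'.1 h.2
      exact ⟨by simpa using h.1, rfl⟩

theorem SameSkeleton.unique {c : ℕ} {S S' S'' : List ℕ} (h : SameSkeleton c S S')
    (h' : SameSkeleton c S S'') (he : freshPart c S' = freshPart c S'') : S' = S'' := by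
  -- After an old entry the height equals the minimum; after a component it is above the minimum. So
  -- the two kinds of steps cannot be confused.
  have key : ∀ {B S₁ S : List ℕ} {x : ℕ}, IsHeightSeq 0 B → topHeight 0 B = 1 →
      x ≤ minHeight c S → x :: S ≠ B.map (· + topHeight c S₁) ++ S₁ := by
    intro B S₁ S x hB hB1 hx he
    have h1 := congrArg (topHeight c) he
    have h2 := congrArg (minHeight c) he
    rw [hB.minHeight_map_append] at h2
    rw [topHeight_map_append] at h1
    have := minHeight_le_topHeight c S₁
    simp only [topHeight_cons, minHeight_cons] at h1 h2
    omega
  induction h generalizing S'' with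
  | nil =>
    generalize hS : ([] : List ℕ) = S at h'
    cases h' with
    | nil => rfl
    | old => simp at hS
    | component h hB hB' h1 h1' =>
      rcases List.map_eq_nil_iff.mp (List.append_eq_nil_iff.mp hS.symm).1
      simp at h1
  | @old x S S' h h1 hx ih =>
    generalize hS : x :: S = S₀ at h'
    cases h' with
    | nil => simp at hS
    | old h2 h3 h4 =>
      obtain ⟨rfl, rfl⟩ := List.cons_eq_cons.mp hS
      rw [freshPart_cons_old (h.minHeight_eq ▸ hx), freshPart_cons_old (h2.minHeight_eq ▸ hx)] at he
      rw [ih h2 he]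
    | component h2 hB hB' h1 h1' => exact absurd hS (key hB h1 hx)
  | @component B B' S S' h hB hB' h1 h1' ih =>
    generalize hS : B.map (· + topHeight c S) ++ S = S₀ at h'
    cases h' with
    | nil =>
      rcases List.map_eq_nil_iff.mp (List.append_eq_nil_iff.mp hS).1
      simp at h1
    | old h2 h3 h4 => exact absurd hS.symm (key hB h1 h4)
    | component h2 hC hC' h3 h3' =>
      obtain ⟨rfl, rfl⟩ := map_append_inj hB hC h1 h3 hS
      rw [hB'.freshPart_map_append, hC'.freshPart_map_append] at he
      obtain ⟨rfl, h5⟩ := map_append_inj hB' hC' h1' h3' he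
      rw [ih h2 h5]

/-! # The word of a height sequence -/

/-- The number of letters of the partition with height sequence `l`. -/
def numLabels : List ℕ → ℕ
  | [] => 0
  | x :: l => if topHeight 0 l < x then numLabels l + 1 else numLabels l

/-- The `i`-th of the letters that may be repeated at the end of the partition with height
sequence `l`, for `1 ≤ i ≤ topHeight 0 l`. -/
def label : List ℕ → ℕ → ℕ
  | [], _ => 0
  | x :: l, i => if topHeight 0 l < x ∧ i = x then numLabels l + 1 else label l i

/-- The reversed canonical form of the partition with height sequence `l`. -/
def labels : List ℕ → List ℕ
  | [] => []
  | x :: l => label (x :: l) x :: labels l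

@[simp] theorem labels_nil : labels [] = [] := rfl

theorem labels_cons (x : ℕ) (l : List ℕ) : labels (x :: l) = label (x :: l) x :: labels l := rfl

theorem numLabels_cons_fresh {x : ℕ} {l : List ℕ} (h : topHeight 0 l < x) :
    numLabels (x :: l) = numLabels l + 1 := by
  simp [numLabels, h]

theorem numLabels_cons_old {x : ℕ} {l : List ℕ} (h : x ≤ topHeight 0 l) :
    numLabels (x :: l) = numLabels l := by
  simp [numLabels, h]

theorem label_cons_self {x : ℕ} {l : List ℕ} (h : topHeight 0 l < x) :
    label (x :: l) x = numLabels l + 1 := by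
  simp [label, h]

theorem label_cons_of_ne {x i : ℕ} {l : List ℕ} (h : i ≠ x) : label (x :: l) i = label l i := by
  simp [label, h]

theorem label_cons_of_le {x i : ℕ} {l : List ℕ} (h : i ≤ topHeight 0 l) :
    label (x :: l) i = label l i := by
  simp only [label, ite_eq_right_iff]
  omega

theorem length_labels (l : List ℕ) : (labels l).length = l.length := by
  induction l with
  | nil => rfl
  | cons x l ih => simp [labels_cons, ih]

theorem labels_append (S P : List ℕ) : ∃ W, labels (S ++ P) = W ++ labels P := by
  induction S with
  | nil => exact ⟨[], rfl⟩
  | cons x S ih =>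
    obtain ⟨W, hW⟩ := ih
    exact ⟨_ :: W, by rw [List.cons_append, labels_cons, hW, List.cons_append]⟩

theorem labels_eq_append {l W₁ W₂ : List ℕ} (h : labels l = W₁ ++ W₂) :
    ∃ S P, l = S ++ P ∧ labels P = W₂ := by
  induction W₁ generalizing l with
  | nil => exact ⟨[], l, rfl, h⟩
  | cons a W ih =>
    rcases l with _ | ⟨x, l⟩
    · simp at h
    · obtain ⟨S, P, rfl, hP⟩ := ih (List.cons.inj h).2
      exact ⟨x :: S, P, rfl, hP⟩

namespace IsHeightSeq

variable {l : List ℕ}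

theorem label_le (hl : IsHeightSeq 0 l) {i : ℕ} (hi : i ≤ topHeight 0 l) :
    label l i ≤ numLabels l := by
  induction l generalizing i with
  | nil => simp [label]
  | cons x l ih =>
    obtain ⟨h, h1, h2⟩ := hl
    simp only [topHeight_cons] at hi
    rcases le_or_gt x (topHeight 0 l) with hx | hx
    · rw [label_cons_of_le (hi.trans hx), numLabels_cons_old hx]
      exact ih h (hi.trans hx)
    · rw [numLabels_cons_fresh hx]
      rcases eq_or_ne i x with rfl | hne
      · rw [label_cons_self hx]
      · rw [label_cons_of_ne hne]
        exact (ih h (by omega)).trans (Nat.le_succ _)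

theorem label_pos (hl : IsHeightSeq 0 l) {i : ℕ} (h0 : 1 ≤ i) (hi : i ≤ topHeight 0 l) :
    1 ≤ label l i := by
  induction l generalizing i with
  | nil => simp only [topHeight_nil] at hi; omega
  | cons x l ih =>
    obtain ⟨h, h1, h2⟩ := hl
    simp only [topHeight_cons] at hi
    rcases le_or_gt i (topHeight 0 l) with hx | hx
    · rw [label_cons_of_le hx]
      exact ih h h0 hx
    · obtain rfl : i = x := by omega
      rw [label_cons_self hx]
      omega

theorem label_lt (hl : IsHeightSeq 0 l) {i j : ℕ} (hij : i < j)
    (hj : j ≤ topHeight 0 l) : label l i < label l j := by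
  induction l generalizing j with
  | nil => simp only [topHeight_nil] at hj; omega
  | cons x l ih =>
    obtain ⟨h, h1, h2⟩ := hl
    simp only [topHeight_cons] at hj
    rcases le_or_gt j (topHeight 0 l) with hx | hx
    · rw [label_cons_of_le hx, label_cons_of_le (hij.le.trans hx)]
      exact ih h hij hx
    · obtain rfl : j = x := by omega
      rw [label_cons_self hx, label_cons_of_ne hij.ne]
      exact Nat.lt_succ_of_le (h.label_le (by omega))

theorem label_injOn (hl : IsHeightSeq 0 l) {i j : ℕ} (hi : i ≤ topHeight 0 l)
    (hj : j ≤ topHeight 0 l) (h : label l i = label l j) : i = j := by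
  rcases lt_trichotomy i j with h1 | h1 | h1
  · exact absurd h (hl.label_lt h1 hj).ne
  · exact h1
  · exact absurd h (hl.label_lt h1 hi).ne'

theorem maxLetter_labels (hl : IsHeightSeq 0 l) : maxLetter (labels l) = numLabels l := by
  induction l with
  | nil => rfl
  | cons x l ih =>
    obtain ⟨h, h1, h2⟩ := hl
    have ih := ih h
    simp only [maxLetter, labels_cons, List.foldr_cons] at ih ⊢
    rw [ih]
    rcases le_or_gt x (topHeight 0 l) with hx | hx
    · rw [label_cons_of_le hx, numLabels_cons_old hx]
      exact max_eq_right (h.label_le hx)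
    · rw [label_cons_self hx, numLabels_cons_fresh hx]
      omega

/-- A letter above `numLabels l` can only come from a rise of the height, and among repeatable
letters `label l` is injective, so the last letter determines the last height. -/
theorem labels_injective {l' : List ℕ} (hl : IsHeightSeq 0 l) (hl' : IsHeightSeq 0 l')
    (h : labels l = labels l') : l = l' := by
  induction l generalizing l' with
  | nil => simpa [length_labels, eq_comm] using congrArg List.length h
  | cons x l ih =>
    rcases l' with _ | ⟨y, l'⟩
    · simp [labels_cons] at h
    · obtain ⟨h1, h2⟩ := List.cons.inj h
      obtain rfl := ih hl.1 hl'.1 h2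
      have hx := hl.2
      have hy := hl'.2
      congr 1
      have hlx := fun h => hl.1.label_le (i := x) h
      have hly := fun h => hl.1.label_le (i := y) h
      rcases le_or_gt x (topHeight 0 l) with h3 | h3 <;>
        rcases le_or_gt y (topHeight 0 l) with h4 | h4
      · rw [label_cons_of_le h3, label_cons_of_le h4] at h1
        exact hl.1.label_injOn h3 h4 h1
      · rw [label_cons_of_le h3, label_cons_self h4] at h1
        have := hlx h3
        omega
      · rw [label_cons_self h3, label_cons_of_le h4] at h1
        have := hly h4
        omega
      · omega

/-! ### Letters written by a continuation -/

section Fresh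

variable {P : List ℕ}

/-- Components up to the least height reached have not been touched by a merger below them, so their
repeatable letters are still those of `P`. -/
theorem label_append_old {S : List ℕ} (hS : IsHeightSeq (topHeight 0 P) S) {i : ℕ}
    (hi : i ≤ minHeight (topHeight 0 P) S) : label (S ++ P) i = label P i := by
  induction S with
  | nil => rfl
  | cons x S ih =>
    simp only [minHeight_cons] at hi
    have := minHeight_le_topHeight (topHeight 0 P) S
    rw [List.cons_append, label_cons_of_le, ih hS.1 (by omega)]
    rw [topHeight_append]
    omega

theorem numLabels_append {S : List ℕ} (hS : IsHeightSeq (topHeight 0 P) S) :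
    numLabels (S ++ P) = numLabels (_root_.freshPart (topHeight 0 P) S) + numLabels P := by
  induction S with
  | nil => simp [numLabels]
  | cons x S ih =>
    obtain ⟨h, h1, h2⟩ := hS
    have h3 := minHeight_le_topHeight (topHeight 0 P) S
    have h4 := topHeight_le_freshPart (topHeight 0 P) S
    rcases le_or_gt x (minHeight (topHeight 0 P) S) with hx | hx
    · rw [freshPart_cons_old hx, List.cons_append, numLabels_cons_old, ih h]
      rw [topHeight_append]
      omega
    · rw [freshPart_cons_fresh hx]
      rcases le_or_gt x (topHeight (topHeight 0 P) S) with hx' | hx'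
      · rw [List.cons_append, numLabels_cons_old, numLabels_cons_old (by omega), ih h]
        rw [topHeight_append]
        omega
      · rw [List.cons_append, numLabels_cons_fresh, numLabels_cons_fresh (by omega), ih h]
        · omega
        · rw [topHeight_append]
          omega

/-- Components above the minimum are the last components of the fresh part, so indices are matched
by counting down from the two top heights. -/
theorem label_append_fresh {S : List ℕ} (hS : IsHeightSeq (topHeight 0 P) S) {i : ℕ}
    (hi : minHeight (topHeight 0 P) S < i) (hi' : i ≤ topHeight (topHeight 0 P) S) :
    label (S ++ P) i = label (_root_.freshPart (topHeight 0 P) S)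
      (topHeight 0 (_root_.freshPart (topHeight 0 P) S) + i - topHeight (topHeight 0 P) S) +
        numLabels P := by
  induction S generalizing i with
  | nil => simp only [minHeight_nil, topHeight_nil] at hi hi'; omega
  | cons x S ih =>
    obtain ⟨h, h1, h2⟩ := hS
    have h3 := minHeight_le_topHeight (topHeight 0 P) S
    have h4 := topHeight_le_freshPart (topHeight 0 P) S
    simp only [minHeight_cons, topHeight_cons] at hi hi'
    rcases le_or_gt x (minHeight (topHeight 0 P) S) with hx | hx
    · omega
    · rw [freshPart_cons_fresh hx]
      simp only [topHeight_cons]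
      rcases le_or_gt i (topHeight (topHeight 0 P) S) with hx' | hx'
      · rw [List.cons_append, label_cons_of_le, ih h (by omega) hx', label_cons_of_le (by omega)]
        · congr 2
          omega
        · rwa [topHeight_append]
      · obtain rfl : i = x := by omega
        rw [List.cons_append, label_cons_self, Nat.add_sub_cancel, label_cons_self (by omega),
          numLabels_append h]
        · omega
        · rwa [topHeight_append]

/-- The continuation `S` of the height sequence `P` writes the letters `W`: those exceeding all
letters of `P` form the word of the fresh part of `S`, and the others are at most the last letter
of `P`. -/
theorem labels_append_filter {S : List ℕ} (hP : IsHeightSeq 0 P)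
    (hS : IsHeightSeq (topHeight 0 P) S) {W : List ℕ} (hW : labels (S ++ P) = W ++ labels P) :
    W.filter (numLabels P < ·) =
        (labels (_root_.freshPart (topHeight 0 P) S)).map (· + numLabels P) ∧
      ∀ a ∈ W, numLabels P < a ∨ a ≤ label P (topHeight 0 P) := by
  induction S generalizing W with
  | nil =>
    obtain rfl : W = [] := by simpa using hW
    simp
  | cons x S ih =>
    obtain ⟨h, h1, h2⟩ := hS
    obtain ⟨W', hW'⟩ := labels_append S P
    have h3 := minHeight_le_topHeight (topHeight 0 P) S
    have h3' := minHeight_le (topHeight 0 P) S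
    have h4 := topHeight_le_freshPart (topHeight 0 P) S
    rw [List.cons_append, labels_cons, hW', ← List.cons_append] at hW
    obtain rfl := List.append_cancel_right hW
    obtain ⟨ih1, ih2⟩ := ih h hW'
    have hxS : IsHeightSeq (topHeight 0 P) (x :: S) := ⟨h, h1, h2⟩
    rcases le_or_gt x (minHeight (topHeight 0 P) S) with hx | hx
    · rw [← List.cons_append (a := x), label_append_old hxS (by simp [hx])]
      have hle := hP.label_le (hx.trans h3')
      rw [List.filter_cons_of_neg (by simpa using hle), freshPart_cons_old hx]
      refine ⟨ih1, List.forall_mem_cons.mpr ⟨Or.inr ?_, ih2⟩⟩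
      rcases (hx.trans h3').lt_or_eq with h5 | h5
      · exact (hP.label_lt h5 le_rfl).le
      · rw [h5]
    · rw [← List.cons_append (a := x), label_append_fresh hxS (by simpa using hx) (by simp)]
      have hf := hxS.freshPart
      rw [freshPart_cons_fresh hx] at hf ⊢
      have h6 := hf.label_pos hf.2.1 (by simp)
      simp only [topHeight_cons, Nat.add_sub_cancel]
      rw [List.filter_cons_of_pos (by simpa [Nat.succ_le_iff] using h6), ih1, labels_cons, List.map_cons]
      exact ⟨rfl, List.forall_mem_cons.mpr ⟨Or.inl (by omega), ih2⟩⟩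

end Fresh

end IsHeightSeq

/-! # Occurrences of patterns -/

/-- `w` has a subsequence that is order-isomorphic to `t`. -/
def Occurs (t w : List ℕ) : Prop :=
  ∃ g : ℕ → ℕ, StrictMonoOn g {x | x ∈ t} ∧ (t.map g).Sublist w

theorem Occurs.mono {t w w' : List ℕ} (h : Occurs t w) (hw : w.Sublist w') : Occurs t w' := by
  obtain ⟨g, hg, hs⟩ := h
  exact ⟨g, hg, hs.trans hw⟩

theorem occurs_map_add_iff {t w : List ℕ} {k : ℕ} : Occurs t (w.map (· + k)) ↔ Occurs t w := by
  constructor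
  · rintro ⟨g, hg, hs⟩
    refine ⟨fun x => g x - k, fun x hx y hy hxy => ?_, ?_⟩
    · obtain ⟨a, -, ha⟩ := List.mem_map.mp (hs.subset (List.mem_map_of_mem (f := g) hx))
      have := hg hx hy hxy
      dsimp only at ha ⊢
      omega
    · simpa [Function.comp_def] using hs.map (· - k)
  · rintro ⟨g, hg, hs⟩
    refine ⟨fun x => g x + k, fun x hx y hy hxy => Nat.add_lt_add_right (hg hx hy hxy) k, ?_⟩
    simpa [Function.comp_def] using hs.map (· + k)

theorem IsHeightSeq.occurs_freshPart_iff {S P t W : List ℕ} (hP : IsHeightSeq 0 P)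
    (hS : IsHeightSeq (topHeight 0 P) S) (hW : labels (S ++ P) = W ++ labels P) :
    Occurs t (labels (_root_.freshPart (topHeight 0 P) S)) ↔
      Occurs t (W.filter (numLabels P < ·)) := by
  rw [(hP.labels_append_filter hS hW).1, occurs_map_add_iff]

/-- Starting the continuation earlier only makes more letters fresh. -/
theorem IsHeightSeq.occurs_freshPart_append {S R P t : List ℕ} (h : IsHeightSeq 0 (S ++ (R ++ P)))
    (ht : Occurs t (labels (_root_.freshPart (topHeight 0 (R ++ P)) S))) :
    Occurs t (labels (_root_.freshPart (topHeight 0 P) (S ++ R))) := by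
  obtain ⟨h1, h2⟩ := isHeightSeq_append.mp h
  obtain ⟨h3, h4⟩ := isHeightSeq_append.mp h1
  obtain ⟨W, hW⟩ := labels_append S (R ++ P)
  obtain ⟨V, hV⟩ := labels_append R P
  rw [h1.occurs_freshPart_iff h2 hW] at ht
  rw [h3.occurs_freshPart_iff (W := W ++ V) ?_ ?_]
  · refine ht.mono (List.Sublist.trans ?_ ((List.sublist_append_left W V).filter _))
    refine List.monotone_filter_right W fun a ha => ?_
    rw [numLabels_append h4] at ha
    simp only [decide_eq_true_eq] at ha ⊢
    omega
  · rw [isHeightSeq_append, ← topHeight_append]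
    exact ⟨h4, h2⟩
  · rw [List.append_assoc, hW, hV, List.append_assoc]

theorem IsHeightSeq.mem_labels {l : List ℕ} (hl : IsHeightSeq 0 l) {a : ℕ} (ha : a ∈ labels l) :
    1 ≤ a ∧ a ≤ numLabels l := by
  induction l with
  | nil => simp at ha
  | cons x l ih =>
    rcases List.mem_cons.mp ha with rfl | ha
    · exact ⟨hl.label_pos hl.2.1 le_rfl, hl.label_le le_rfl⟩
    · refine ⟨(ih hl.1 ha).1, (ih hl.1 ha).2.trans ?_⟩
      simp only [numLabels]
      split_ifs <;> omega

theorem exists_append_cons_of_sublist {a : ℕ} {u w : List ℕ} (h : (a :: u).Sublist w) :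
    ∃ W₁ W₂, w = W₁ ++ a :: W₂ ∧ u.Sublist W₂ := by
  induction w with
  | nil => simp at h
  | cons b w ih =>
    rcases List.sublist_cons_iff.mp h with h | ⟨r, hr, h⟩
    · obtain ⟨W₁, W₂, rfl, hu⟩ := ih h
      exact ⟨b :: W₁, W₂, rfl, hu⟩
    · obtain ⟨h1, h2⟩ := List.cons.inj hr
      subst h1 h2
      exact ⟨[], w, rfl, h⟩

/-- The cut is chosen so that `W₂` begins exactly with the copy of the first letter of `v`; in
reversed order this is the last letter of the copy of the first pattern. -/
theorem exists_append_of_append_sublist {u v w : List ℕ} (h : (u ++ v).Sublist w) :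
    ∃ W₁ W₂, w = W₁ ++ W₂ ∧ u.Sublist W₁ ∧ v.Sublist W₂ ∧
      ∀ a ∈ W₂.head?, v.head? = some a := by
  obtain ⟨W₁, W₂, rfl, h1, h2⟩ := List.append_sublist_iff.mp h
  rcases v with _ | ⟨a, v⟩
  · exact ⟨W₁ ++ W₂, [], by simp, h1.trans (List.sublist_append_left _ _), by simp⟩
  · obtain ⟨V₁, V₂, rfl, h3⟩ := exists_append_cons_of_sublist h2
    exact ⟨W₁ ++ V₁, a :: V₂, by simp, h1.trans (List.sublist_append_left _ _),
      h3.cons_cons a, by simp⟩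

/-- Cut at the last letter of the copy of `s`. Later letters that are not fresh are at most this
letter, while the copy of `t` lies above it and is therefore fresh. -/
theorem IsHeightSeq.occurs_append_iff {l s t : List ℕ} {k : ℕ} (hl : IsHeightSeq 0 l)
    (hs : ∀ x ∈ s, x ≤ k) (ht : ∀ x ∈ t, 1 ≤ x) :
    Occurs (t.map (· + k) ++ s) (labels l) ↔ ∃ S P, l = S ++ P ∧ Occurs s (labels P) ∧
      Occurs t (labels (_root_.freshPart (topHeight 0 P) S)) := by
  constructor
  · rintro ⟨g, hg, hsub⟩
    rw [List.map_append] at hsub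
    obtain ⟨W₁, W₂, hW, h1, h2, h4⟩ := exists_append_of_append_sublist hsub
    obtain ⟨S, P, rfl, rfl⟩ := labels_eq_append hW
    obtain ⟨hP, hS⟩ := isHeightSeq_append.mp hl
    refine ⟨S, P, rfl, ⟨g, hg.mono fun x hx => List.mem_append_right _ hx, h2⟩, ?_⟩
    rw [hP.occurs_freshPart_iff hS hW]
    refine ⟨fun x => g (x + k), fun x hx y hy hxy => hg ?_ ?_ (Nat.add_lt_add_right hxy k), ?_⟩
    · exact List.mem_append_left _ (List.mem_map_of_mem hx)
    · exact List.mem_append_left _ (List.mem_map_of_mem hy)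
    · rw [List.map_map] at h1
      have hf := h1.filter (numLabels P < ·)
      rwa [List.filter_eq_self.mpr] at hf
      intro b hb
      obtain ⟨x, hx, rfl⟩ := List.mem_map.mp hb
      rcases (hP.labels_append_filter hS hW).2 _ (h1.subset hb) with h | h
      · simpa using h
      · have hx1 := ht x hx
        -- For empty `P` the default `label [] _ = 0` contradicts positivity of letters. Otherwise
        -- `label (y :: P) y` is the last letter of the start, which is the image of the head of
        -- `s`.
        rcases P with _ | ⟨y, P⟩
        · have h5 := hl.mem_labels (hW ▸ List.mem_append_left _ (h1.subset hb))
          simp only [label] at h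
          omega
        · have h5 := h4 (label (y :: P) y) rfl
          rcases s with _ | ⟨z, s⟩
          · simp at h5
          · have h6 := hs z (by simp)
            have h7 := hg (a := z) (b := x + k) (by simp)
              (List.mem_append_left _ (List.mem_map_of_mem hx)) (by omega)
            simp only [List.map_cons, List.head?_cons, Option.some.injEq] at h5
            simp only [topHeight_cons, Function.comp_apply] at h
            omega
  · rintro ⟨S, P, rfl, ⟨g, hg, hgs⟩, h⟩
    obtain ⟨hP, hS⟩ := isHeightSeq_append.mp hl
    obtain ⟨W, hW⟩ := labels_append S P
    obtain ⟨h1, -⟩ := hP.labels_append_filter hS hW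
    obtain ⟨g', hg', hgt⟩ := h
    have hle : ∀ x ∈ s, g x ≤ numLabels P := fun x hx =>
      (hP.mem_labels (hgs.subset (List.mem_map_of_mem hx))).2
    have hpos : ∀ x ∈ t, 1 ≤ g' x := fun x hx =>
      (hS.freshPart.mem_labels (hgt.subset (List.mem_map_of_mem hx))).1
    -- Letters up to `k` belong to `s` and are sent into `P`; larger ones belong to the shifted `t`
    -- and are sent above all letters of `P`.
    refine ⟨fun x => if x ≤ k then g x else g' (x - k) + numLabels P, ?_, ?_⟩
    · intro x hx y hy hxy
      have hx' : (x ≤ k ∧ x ∈ s) ∨ (k < x ∧ x - k ∈ t) := by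
        rcases List.mem_append.mp hx with h | h
        · obtain ⟨a, ha, rfl⟩ := List.mem_map.mp h
          exact Or.inr ⟨by have := ht a ha; omega, by simpa using ha⟩
        · exact Or.inl ⟨hs x h, h⟩
      have hy' : (y ≤ k ∧ y ∈ s) ∨ (k < y ∧ y - k ∈ t) := by
        rcases List.mem_append.mp hy with h | h
        · obtain ⟨a, ha, rfl⟩ := List.mem_map.mp h
          exact Or.inr ⟨by have := ht a ha; omega, by simpa using ha⟩
        · exact Or.inl ⟨hs y h, h⟩
      rcases hx' with ⟨hx1, hx2⟩ | ⟨hx1, hx2⟩ <;> rcases hy' with ⟨hy1, hy2⟩ | ⟨hy1, hy2⟩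
      · simpa [hx1, hy1] using hg hx2 hy2 hxy
      · have := hle x hx2
        have := hpos _ hy2
        simp only [hx1, hy1.not_ge, if_true, if_false]
        omega
      · omega
      · have := hg' hx2 hy2 (by omega)
        simp only [hx1.not_ge, hy1.not_ge, if_false]
        omega
    · rw [hW, List.map_append]
      refine List.Sublist.append ?_ ?_
      · refine List.Sublist.trans ?_ (List.filter_sublist (p := (numLabels P < ·)))
        rw [h1]
        convert hgt.map (· + numLabels P) using 1
        rw [List.map_map, List.map_map]
        refine List.map_congr_left fun x hx => ?_
        have := ht x hx
        simp [show ¬ x + k ≤ k by omega]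
      · convert hgs using 1
        refine List.map_congr_left fun x hx => ?_
        simp [hs x hx]

/-! # Replacing a part of a height sequence -/

/-- `f` maps the height sequences of partitions avoiding `t` to height sequences of partitions
avoiding `t'`, preserving length and final height, and `g` is a left inverse of it. -/
def Converts (t t' : List ℕ) (f g : List ℕ → List ℕ) : Prop :=
  ∀ l, IsHeightSeq 0 l → ¬ Occurs t (labels l) →
    IsHeightSeq 0 (f l) ∧ ¬ Occurs t' (labels (f l)) ∧ (f l).length = l.length ∧
      topHeight 0 (f l) = topHeight 0 l ∧ g (f l) = l

open Classical in
/-- If `l = S ++ P` with `D S P`, then replace `S` by `φ S P` and `P` by `ψ P` in `l`. -/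
noncomputable def modifySplit (D : List ℕ → List ℕ → Prop) (φ : List ℕ → List ℕ → List ℕ)
    (ψ : List ℕ → List ℕ) (l : List ℕ) : List ℕ :=
  if h : ∃ q : List ℕ × List ℕ, l = q.1 ++ q.2 ∧ D q.1 q.2 then
    φ h.choose.1 h.choose.2 ++ ψ h.choose.2 else l

theorem modifySplit_of_forall_not {D : List ℕ → List ℕ → Prop} {φ : List ℕ → List ℕ → List ℕ}
    {ψ : List ℕ → List ℕ} {l : List ℕ} (h : ∀ S P, l = S ++ P → ¬ D S P) :
    modifySplit D φ ψ l = l :=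
  dif_neg fun ⟨q, h1, h2⟩ => h q.1 q.2 h1 h2

theorem modifySplit_append {D : List ℕ → List ℕ → Prop} {φ : List ℕ → List ℕ → List ℕ}
    {ψ : List ℕ → List ℕ} (hD : ∀ S P S' P', S ++ P = S' ++ P' → D S P → D S' P' → P = P')
    {S P : List ℕ} (h : D S P) : modifySplit D φ ψ (S ++ P) = φ S P ++ ψ P := by
  have hex : ∃ q : List ℕ × List ℕ, S ++ P = q.1 ++ q.2 ∧ D q.1 q.2 := ⟨(S, P), rfl, h⟩
  obtain ⟨h1, h2⟩ := hex.choose_spec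
  have h3 := hD _ _ _ _ h1 h h2
  have h4 : S = hex.choose.1 := by
    rw [← h3] at h1
    exact List.append_cancel_right h1
  rw [modifySplit, dif_pos hex, ← h3, ← h4]

/-! ### Replacing the part before an occurrence of a pattern -/

/-- `S` is the shortest end of a height sequence, continuing the height `c`, whose fresh part
contains `t`. -/
def IsShortestEnd (t : List ℕ) (c : ℕ) (S : List ℕ) : Prop :=
  Occurs t (labels (freshPart c S)) ∧
    ∀ A R, S = A ++ R → Occurs t (labels (freshPart (topHeight c R) A)) → R = []

theorem exists_isShortestEnd {t S P : List ℕ}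
    (h : Occurs t (labels (freshPart (topHeight 0 P) S))) :
    ∃ A R, S = A ++ R ∧ IsShortestEnd t (topHeight 0 (R ++ P)) A := by
  induction hn : S.length using Nat.strong_induction_on generalizing S P with
  | _ n ih =>
    by_cases hS : IsShortestEnd t (topHeight 0 P) S
    · exact ⟨S, [], by simp, hS⟩
    · simp only [IsShortestEnd, h, true_and, not_forall] at hS
      obtain ⟨A, R, rfl, hA, hR⟩ := hS
      rw [← topHeight_append] at hA
      have := List.length_pos_iff.mpr hR
      obtain ⟨A', R', rfl, h'⟩ := ih A.length (by simp at hn; omega) hA rfl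
      exact ⟨A', R' ++ R, by simp, by simpa using h'⟩

theorem IsShortestEnd.unique {t S P S' P' : List ℕ} (he : S ++ P = S' ++ P')
    (h : IsShortestEnd t (topHeight 0 P) S) (h' : IsShortestEnd t (topHeight 0 P') S') :
    P = P' := by
  rcases List.append_eq_append_iff.mp he with ⟨R, rfl, rfl⟩ | ⟨R, rfl, rfl⟩
  · rw [topHeight_append] at h
    rw [h'.2 S R rfl h.1, List.nil_append]
  · rw [topHeight_append] at h'
    rw [h.2 S' R rfl h'.1, List.nil_append]

/-- `IsShortestEnd` sees the start only through its final height, which `f` preserves. So the cut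
survives, and `g` applied at the same cut restores the sequence. -/
theorem Converts.modify_start {s s' t : List ℕ} {k k' : ℕ} {f g : List ℕ → List ℕ}
    (h : Converts s s' f g) (hs : ∀ x ∈ s, x ≤ k) (hs' : ∀ x ∈ s', x ≤ k')
    (ht : ∀ x ∈ t, 1 ≤ x) :
    Converts (t.map (· + k) ++ s) (t.map (· + k') ++ s')
      (modifySplit (fun S P => IsShortestEnd t (topHeight 0 P) S) (fun S _ => S) f)
      (modifySplit (fun S P => IsShortestEnd t (topHeight 0 P) S) (fun S _ => S) g) := by
  intro l hl hav
  rw [hl.occurs_append_iff hs ht] at hav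
  have hD := @IsShortestEnd.unique t
  by_cases hex : ∃ S P, l = S ++ P ∧ IsShortestEnd t (topHeight 0 P) S
  · obtain ⟨S, P, rfl, hSP⟩ := hex
    obtain ⟨hP, hS⟩ := isHeightSeq_append.mp hl
    obtain ⟨h1, h2, h3, h4, h5⟩ := h P hP fun hP => hav ⟨S, P, rfl, hP, hSP.1⟩
    have hl' : IsHeightSeq 0 (S ++ f P) := isHeightSeq_append.mpr ⟨h1, h4 ▸ hS⟩
    rw [modifySplit_append (fun S P S' P' => hD) hSP,
      modifySplit_append (fun S P S' P' => hD) (h4.symm ▸ hSP), h5, hl'.occurs_append_iff hs' ht]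
    refine ⟨hl', ?_, by simp [h3], by rw [topHeight_append, topHeight_append, h4], rfl⟩
    rintro ⟨S', P', he, hs1, ht1⟩
    rw [← h4] at hSP
    -- By minimality of `S`, any cut witnessing the new pattern has its start inside `f P`, which
    -- avoids `s'`.
    have key : ∀ R, f P = R ++ P' → False := fun R hR =>
      h2 (hs1.mono (hR ▸ (labels_append R P').elim fun W hW => hW ▸ List.sublist_append_right _ _))
    rcases List.append_eq_append_iff.mp he with ⟨R, rfl, hR⟩ | ⟨R, rfl, rfl⟩
    · exact key R hR
    · rw [topHeight_append] at ht1
      obtain rfl := hSP.2 S' R rfl ht1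
      exact key [] rfl
  · have hex' : ∀ S P, l = S ++ P → ¬ IsShortestEnd t (topHeight 0 P) S :=
      fun S P h1 h2 => hex ⟨S, P, h1, h2⟩
    rw [modifySplit_of_forall_not hex', modifySplit_of_forall_not hex', hl.occurs_append_iff hs' ht]
    refine ⟨hl, ?_, rfl, rfl, rfl⟩
    rintro ⟨S, P, rfl, -, h2⟩
    obtain ⟨A, R, rfl, hA⟩ := exists_isShortestEnd h2
    exact hex' A (R ++ P) (by simp) hA

/-! ### Replacing the fresh part after an occurrence of a pattern -/

/-- `P` is the shortest start of a height sequence that contains `s`. -/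
def IsShortestStart (s P : List ℕ) : Prop :=
  Occurs s (labels P) ∧ ∀ A R, P = A ++ R → Occurs s (labels R) → A = []

theorem exists_isShortestStart {s P : List ℕ} (h : Occurs s (labels P)) :
    ∃ A R, P = A ++ R ∧ IsShortestStart s R := by
  induction hn : P.length using Nat.strong_induction_on generalizing P with
  | _ n ih =>
    by_cases hP : IsShortestStart s P
    · exact ⟨[], P, by simp, hP⟩
    · simp only [IsShortestStart, h, true_and, not_forall] at hP
      obtain ⟨A, R, rfl, hR, hA⟩ := hP
      have := List.length_pos_iff.mpr hA
      obtain ⟨A', R', rfl, h'⟩ := ih R.length (by simp at hn; omega) hR rfl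
      exact ⟨A ++ A', R', by simp, h'⟩

theorem IsShortestStart.unique {s S P S' P' : List ℕ} (he : S ++ P = S' ++ P')
    (h : IsShortestStart s P) (h' : IsShortestStart s P') : P = P' := by
  rcases List.append_eq_append_iff.mp he with ⟨R, rfl, rfl⟩ | ⟨R, rfl, rfl⟩
  · rw [h.2 R P' rfl h'.1, List.nil_append]
  · rw [h'.2 R P rfl h.1, List.nil_append]

open Classical in
/-- Replace the fresh part of the continuation `S` of a sequence of height `c` by `U`. -/
noncomputable def replaceFresh (c : ℕ) (S U : List ℕ) : List ℕ :=
  if h : ∃ S', SameSkeleton c S S' ∧ freshPart c S' = U then h.choose else S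

theorem replaceFresh_spec {c : ℕ} {S U : List ℕ} (hS : IsHeightSeq c S) (hU : IsHeightSeq 0 U)
    (h : topHeight 0 U = topHeight 0 (freshPart c S)) :
    SameSkeleton c S (replaceFresh c S U) ∧ freshPart c (replaceFresh c S U) = U := by
  have hex := exists_sameSkeleton hS hU h
  rw [replaceFresh, dif_pos hex]
  exact hex.choose_spec

theorem SameSkeleton.replaceFresh_eq {c : ℕ} {S S' : List ℕ} (h : SameSkeleton c S S') :
    replaceFresh c S (freshPart c S') = S' := by
  have hex : ∃ S'', SameSkeleton c S S'' ∧ freshPart c S'' = freshPart c S' := ⟨S', h, rfl⟩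
  rw [replaceFresh, dif_pos hex]
  exact hex.choose_spec.1.unique h hex.choose_spec.2

/-- The start `P` is untouched and stays the shortest one containing `s`. The new continuation has
fresh part `f` of the old one and the same skeleton, so replacing back is unambiguous. -/
theorem Converts.modify_end {s t t' : List ℕ} {k : ℕ} {f g : List ℕ → List ℕ}
    (h : Converts t t' f g) (hs : ∀ x ∈ s, x ≤ k) (ht : ∀ x ∈ t, 1 ≤ x)
    (ht' : ∀ x ∈ t', 1 ≤ x) :
    Converts (t.map (· + k) ++ s) (t'.map (· + k) ++ s)
      (modifySplit (fun _ P => IsShortestStart s P) (fun S P =>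
        replaceFresh (topHeight 0 P) S (f (freshPart (topHeight 0 P) S))) id)
      (modifySplit (fun _ P => IsShortestStart s P) (fun S P =>
        replaceFresh (topHeight 0 P) S (g (freshPart (topHeight 0 P) S))) id) := by
  intro l hl hav
  rw [hl.occurs_append_iff hs ht] at hav
  have hD := @IsShortestStart.unique s
  by_cases hex : ∃ S P, l = S ++ P ∧ IsShortestStart s P
  · obtain ⟨S, P, rfl, hSP⟩ := hex
    obtain ⟨hP, hS⟩ := isHeightSeq_append.mp hl
    obtain ⟨h1, h2, h3, h4, h5⟩ := h _ hS.freshPart fun hT => hav ⟨S, P, rfl, hSP.1, hT⟩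
    obtain ⟨h6, h7⟩ := replaceFresh_spec hS h1 h4
    have hlen := h6.length_add
    rw [modifySplit_append (fun S P S' P' he h h' => hD he h h') hSP,
      id_eq, modifySplit_append (fun S P S' P' he h h' => hD he h h') hSP, h7, h5, h6.symm.replaceFresh_eq]
    rw [h7, h3] at hlen
    have hl' := isHeightSeq_append.mpr ⟨hP, h6.isHeightSeq⟩
    rw [hl'.occurs_append_iff hs ht']
    refine ⟨hl', ?_, ?_, ?_, rfl⟩
    · rintro ⟨S', P', he, hs1, ht1⟩
      -- By minimality of `P`, any cut witnessing the new pattern lies at or after `P`; its fresh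
      -- part then embeds in the one over `P`, which avoids `t'`.
      have key : ∀ R, replaceFresh (topHeight 0 P) S (f (freshPart (topHeight 0 P) S)) = S' ++ R →
          P' = R ++ P → False := by
        rintro R hR rfl
        rw [he] at hl'
        have := hl'.occurs_freshPart_append ht1
        rw [← hR, h7] at this
        exact h2 this
      rcases List.append_eq_append_iff.mp he with ⟨R, h8, h9⟩ | ⟨R, h8, h9⟩
      · obtain rfl := hSP.2 R P' h9 hs1
        exact key [] (by simpa using h8.symm) (by simpa using h9.symm)
      · exact key R h8 h9
    · simp only [List.length_append]
      omega
    · rw [topHeight_append, topHeight_append, h6.topHeight_eq]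
  · have hex' : ∀ S P, l = S ++ P → ¬ IsShortestStart s P :=
      fun S P h1 h2 => hex ⟨S, P, h1, h2⟩
    rw [modifySplit_of_forall_not hex', modifySplit_of_forall_not hex', hl.occurs_append_iff hs ht']
    refine ⟨hl, ?_, rfl, rfl, rfl⟩
    rintro ⟨S, P, rfl, h1, -⟩
    obtain ⟨A, R, rfl, hA⟩ := exists_isShortestStart h1
    exact hex' (S ++ A) R (by simp) hA

/-! # Height sequences of non-crossing partitions -/

theorem maxLetter_reverse (w : List ℕ) : maxLetter w.reverse = maxLetter w := by
  induction w with
  | nil => rfl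
  | cons a w ih =>
    rw [List.reverse_cons, maxLetter_append, ih]
    simp [maxLetter, max_comm]

theorem isCanonical_append_singleton {w : List ℕ} {a : ℕ} :
    IsCanonical (w ++ [a]) ↔ IsCanonical w ∧ 1 ≤ a ∧ a ≤ maxLetter w + 1 := by
  refine ⟨fun h => ⟨h.prefix, h w a [] rfl⟩, ?_⟩
  rintro ⟨hw, ha⟩ u b v he
  rcases v.eq_nil_or_concat with rfl | ⟨v, c, rfl⟩
  · obtain ⟨rfl, h⟩ := List.append_inj' he rfl
    obtain rfl := List.singleton_inj.mp h
    exact ha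
  · rw [List.concat_eq_append, ← List.cons_append, ← List.append_assoc] at he
    exact hw u b v (List.append_inj' he rfl).1

namespace IsHeightSeq

variable {l : List ℕ}

theorem isCanonical (hl : IsHeightSeq 0 l) : IsCanonical (labels l).reverse := by
  induction l with
  | nil => exact SetPartition.empty.canonical
  | cons x l ih =>
    rw [labels_cons, List.reverse_cons, isCanonical_append_singleton, maxLetter_reverse,
      hl.1.maxLetter_labels]
    refine ⟨ih hl.1, hl.label_pos hl.2.1 le_rfl, (hl.label_le le_rfl).trans ?_⟩
    simp only [numLabels]
    split_ifs <;> omega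

theorem mem_labels_iff (hl : IsHeightSeq 0 l) {a : ℕ} :
    a ∈ labels l ↔ 1 ≤ a ∧ a ≤ numLabels l := by
  rw [← List.mem_reverse, hl.isCanonical.mem_iff, maxLetter_reverse, hl.maxLetter_labels]

/-- Letters first appear in increasing order, so the first `a` comes after some `b`. -/
theorem pair_sublist_labels (hl : IsHeightSeq 0 l) {a b : ℕ} (hb : 1 ≤ b) (hba : b < a)
    (ha : a ≤ numLabels l) : [a, b].Sublist (labels l) := by
  induction l with
  | nil => simp only [numLabels] at ha; omega
  | cons x l ih =>
    rw [labels_cons]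
    rcases le_or_gt a (numLabels l) with h | h
    · exact (ih hl.1 h).cons _
    · rcases le_or_gt x (topHeight 0 l) with hx | hx
      · rw [numLabels_cons_old hx] at ha
        omega
      · rw [numLabels_cons_fresh hx] at ha
        obtain rfl : a = numLabels l + 1 := by omega
        rw [label_cons_self hx]
        exact (List.singleton_sublist.mpr (hl.1.mem_labels_iff.mpr ⟨hb, by omega⟩)).cons_cons _

/-- The letters that may be repeated without creating a crossing are those given by `label`. -/
theorem exists_label_eq_iff (hl : IsHeightSeq 0 l) {a : ℕ} (ha : 1 ≤ a)
    (ha' : a ≤ numLabels l) : (∃ i, 1 ≤ i ∧ i ≤ topHeight 0 l ∧ label l i = a) ↔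
      ∀ b < a, ¬ [b, a, b].Sublist (labels l) := by
  induction l with
  | nil => simp only [numLabels] at ha'; omega
  | cons x l ih =>
    obtain ⟨h, h1, h2⟩ := hl
    have hcons : ∀ b, [b, a, b].Sublist (labels (x :: l)) ↔
        [b, a, b].Sublist (labels l) ∨ b = label (x :: l) x ∧ [a, b].Sublist (labels l) := by
      intro b
      rw [labels_cons, List.sublist_cons_iff]
      simp
    simp only [hcons, topHeight_cons]
    rcases le_or_gt a (numLabels l) with h3 | h3
    · have ih := ih h h3
      rcases le_or_gt x (topHeight 0 l) with hx | hx
      · constructor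
        · rintro ⟨i, h4, h5, rfl⟩ b hb (hs | ⟨rfl, hs⟩)
          · rw [label_cons_of_le (h5.trans hx)] at ih hb hs
            exact ih.mp ⟨i, h4, h5.trans hx, rfl⟩ b hb hs
          · rcases h5.lt_or_eq with h5 | rfl
            · exact hb.not_gt (IsHeightSeq.label_lt (l := x :: l) ⟨h, h1, h2⟩ h5 le_rfl)
            · omega
        · intro hs
          obtain ⟨i, h4, h5, rfl⟩ := ih.mpr fun b hb hb' => hs b hb (Or.inl hb')
          refine ⟨i, h4, ?_, label_cons_of_le h5⟩
          by_contra! hix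
          -- Returning to height `x < i` closes component `i`: its letter now lies between two
          -- copies of `label l x`.
          refine hs (label l x) (h.label_lt hix h5) (Or.inr ⟨(label_cons_of_le hx).symm, ?_⟩)
          exact h.pair_sublist_labels (h.label_pos h1 hx) (h.label_lt hix h5) h3
      · rw [label_cons_self hx]
        constructor
        · rintro ⟨i, h4, h5, h6⟩ b hb (hs | ⟨rfl, hs⟩)
          · rcases h5.lt_or_eq with h5 | rfl
            · exact ih.mp ⟨i, h4, by omega, by rwa [label_cons_of_ne h5.ne] at h6⟩ b hb hs
            · rw [label_cons_self hx] at h6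
              omega
          · omega
        · intro hs
          obtain ⟨i, h4, h5, rfl⟩ := ih.mpr fun b hb hb' => hs b hb (Or.inl hb')
          exact ⟨i, h4, by omega, label_cons_of_le h5⟩
    · rcases le_or_gt x (topHeight 0 l) with hx | hx
      · rw [numLabels_cons_old hx] at ha'
        omega
      · rw [numLabels_cons_fresh hx] at ha'
        obtain rfl : a = numLabels l + 1 := by omega
        rw [label_cons_self hx]
        refine ⟨fun _ b hb => ?_, fun _ => ⟨x, h1, le_rfl, label_cons_self hx⟩⟩
        rintro (hs | ⟨rfl, hs⟩)
        · have := (h.mem_labels_iff.mp (hs.subset (a := numLabels l + 1) (by simp))).2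
          omega
        · omega

end IsHeightSeq

/-! ### The words of height sequences are exactly the non-crossing ones -/

theorem occurs_2121_iff {w : List ℕ} :
    Occurs [2, 1, 2, 1] w ↔ ∃ a b, b < a ∧ [a, b, a, b].Sublist w := by
  constructor
  · rintro ⟨g, hg, hs⟩
    exact ⟨g 2, g 1, hg (by simp) (by simp) (by norm_num), hs⟩
  · rintro ⟨a, b, hab, hs⟩
    refine ⟨fun x => if x = 1 then b else a, ?_, by simpa using hs⟩
    intro x hx y hy hxy
    simp only [List.mem_cons, List.not_mem_nil, or_false, Set.mem_ofPred_eq] at hx hy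
    obtain rfl : x = 1 := by omega
    obtain rfl : y = 2 := by omega
    simpa using hab

theorem occurs_2121_cons_iff {c : ℕ} {w : List ℕ} :
    Occurs [2, 1, 2, 1] (c :: w) ↔
      Occurs [2, 1, 2, 1] w ∨ ∃ b < c, [b, c, b].Sublist w := by
  simp only [occurs_2121_iff, List.sublist_cons_iff (l' := w)]
  constructor
  · rintro ⟨a, b, hab, hs | ⟨r, hr, hs⟩⟩
    · exact Or.inl ⟨a, b, hab, hs⟩
    · obtain ⟨h1, h2⟩ := List.cons.inj hr
      subst h1 h2
      exact Or.inr ⟨b, hab, hs⟩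
  · rintro (⟨a, b, hab, hs⟩ | ⟨b, hb, hs⟩)
    · exact ⟨a, b, hab, Or.inl hs⟩
    · exact ⟨c, b, hb, Or.inr ⟨_, rfl, hs⟩⟩

theorem IsHeightSeq.not_occurs_2121 {l : List ℕ} (hl : IsHeightSeq 0 l) :
    ¬ Occurs [2, 1, 2, 1] (labels l) := by
  induction l with
  | nil => simp [occurs_2121_iff]
  | cons x l ih =>
    rw [labels_cons, occurs_2121_cons_iff]
    rintro (h | ⟨b, hb, hs⟩)
    · exact ih hl.1 h
    · have h2 := hl.2.1
      exact (hl.exists_label_eq_iff (hl.label_pos h2 le_rfl) (hl.label_le le_rfl)).mp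
        ⟨x, h2, le_rfl, rfl⟩ b hb (hs.cons _)

theorem exists_labels_eq {w : List ℕ} (hw : IsCanonical w.reverse)
    (hnc : ¬ Occurs [2, 1, 2, 1] w) : ∃ l, IsHeightSeq 0 l ∧ labels l = w := by
  induction w with
  | nil => exact ⟨[], by simp, rfl⟩
  | cons c w ih =>
    rw [List.reverse_cons, isCanonical_append_singleton, maxLetter_reverse] at hw
    rw [occurs_2121_cons_iff, not_or] at hnc
    obtain ⟨hw, h1, h2⟩ := hw
    obtain ⟨l, hl, rfl⟩ := ih hw hnc.1
    rw [hl.maxLetter_labels] at h2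
    rcases h2.lt_or_eq with h2 | rfl
    · obtain ⟨i, h3, h4, rfl⟩ := (hl.exists_label_eq_iff h1 (by omega)).mpr
        fun b hb hs => hnc.2 ⟨b, hb, hs⟩
      exact ⟨i :: l, ⟨hl, h3, by omega⟩, by rw [labels_cons, label_cons_of_le h4]⟩
    · exact ⟨(topHeight 0 l + 1) :: l, ⟨hl, by omega, le_rfl⟩, by
        rw [labels_cons, label_cons_self (by omega)]⟩

theorem IsHeightSeq.label_one {l : List ℕ} (hl : IsHeightSeq 0 l) (h : 1 ≤ topHeight 0 l) :
    label l 1 = 1 := by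
  induction l with
  | nil => simp at h
  | cons x l ih =>
    rcases Nat.eq_zero_or_pos (topHeight 0 l) with h0 | h0
    · obtain rfl : x = 1 := by have := hl.2; omega
      rcases l with _ | ⟨y, l⟩
      · rfl
      · have := hl.1.2.1
        simp only [topHeight_cons] at h0
        omega
    · rw [label_cons_of_le h0, ih hl.1 h0]

theorem IsHeightSeq.labels_map_append {B S : List ℕ} (hB : IsHeightSeq 0 B)
    (hS : IsHeightSeq 0 S) : labels (B.map (· + topHeight 0 S) ++ S) =
      (labels B).map (· + numLabels S) ++ labels S := by
  have h1 := hB.map_append (isHeightSeq_nil (topHeight 0 S))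
  have h2 := hB.freshPart_map_append (topHeight 0 S) []
  simp only [topHeight_nil, List.append_nil, freshPart_nil, Nat.add_zero, List.map_id_fun'] at h1 h2
  obtain ⟨W, hW⟩ := labels_append (B.map (· + topHeight 0 S)) S
  have h3 := (hS.labels_append_filter h1 hW).1
  rw [h2, id] at h3
  -- Every entry of the shifted block is fresh, so the filter has full length and removes nothing.
  rw [hW, ← h3, (List.filter_sublist (l := W)).eq_of_length]
  have h4 := congrArg List.length hW
  rw [h3]
  simp only [length_labels, List.length_append, List.length_map] at h4 ⊢
  omega

/-! ### Partitions given by height sequences, and their components -/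

namespace SetPartition

theorem contains_iff {π τ : SetPartition} :
    π.Contains τ ↔ Occurs τ.word.reverse π.word.reverse := by
  have : Occurs τ.word.reverse π.word.reverse ↔
      ∃ g : ℕ → ℕ, StrictMonoOn g {x | x ∈ τ.word} ∧ (τ.word.map g).Sublist π.word := by
    simp [Occurs, List.map_reverse, List.reverse_sublist]
  rw [this, Contains]
  generalize π.word = w
  generalize τ.word = t
  constructor
  · rintro ⟨f, hf, h⟩
    have hidx : ∀ {x}, x ∈ t → t.idxOf x < t.length := fun hx => List.idxOf_lt_length_iff.mpr hx
    -- A letter is sent to the value at the image of its first position; other positions with the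
    -- same letter give the same value, as neither strict inequality can hold.
    refine ⟨fun x => if hx : x ∈ t then w.get (f ⟨t.idxOf x, hidx hx⟩) else 0, ?_, ?_⟩
    · intro x hx y hy hxy
      have hx : x ∈ t := hx
      have hy : y ∈ t := hy
      simp only [hx, hy, dif_pos]
      rw [h]
      simpa using hxy
    · rw [List.sublist_iff_exists_fin_orderEmbedding_get_eq]
      refine ⟨(Fin.castOrderIso (by simp)).toOrderEmbedding.trans
        (OrderEmbedding.ofStrictMono f hf), fun i => ?_⟩
      have hi : (i : ℕ) < t.length := by simpa using i.2
      simp only [List.get_eq_getElem, List.getElem_map, List.getElem_mem, dif_pos]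
      set j : Fin t.length := ⟨t.idxOf t[(i : ℕ)], hidx (List.getElem_mem hi)⟩
      have hj : t.get j = t.get ⟨i, hi⟩ := by simp [j]
      refine le_antisymm (not_lt.mp fun hlt => ?_) (not_lt.mp fun hlt => ?_)
      · exact ((h ⟨i, hi⟩ j).mp hlt).ne hj.symm
      · exact ((h j ⟨i, hi⟩).mp hlt).ne hj
  · rintro ⟨g, hg, hs⟩
    obtain ⟨f, hf⟩ := List.sublist_iff_exists_fin_orderEmbedding_get_eq.mp hs
    refine ⟨fun i => f (Fin.cast (by simp) i), fun i j hij => f.strictMono hij, fun i j => ?_⟩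
    rw [← hf, ← hf]
    simpa using hg.lt_iff_lt (List.getElem_mem i.2) (List.getElem_mem j.2)

/-- The partition with a given height sequence. -/
def ofHeights (l : List ℕ) (hl : IsHeightSeq 0 l) : SetPartition :=
  ⟨(labels l).reverse, hl.isCanonical⟩

theorem nonCrossing_iff {π : SetPartition} :
    π.NonCrossing ↔ ∃ l hl, ofHeights l hl = π := by
  rw [NonCrossing, Avoids, contains_iff]
  constructor
  · intro h
    obtain ⟨l, hl, hw⟩ := exists_labels_eq (w := π.word.reverse)
      (by simpa using π.canonical) h
    exact ⟨l, hl, SetPartition.ext (by simp [ofHeights, hw])⟩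
  · rintro ⟨l, hl, rfl⟩
    simpa [ofHeights, p1212] using hl.not_occurs_2121

theorem numBlocks_ofHeights {l : List ℕ} (hl : IsHeightSeq 0 l) :
    (ofHeights l hl).numBlocks = numLabels l := by
  rw [numBlocks_eq_maxLetter, ofHeights, maxLetter_reverse, hl.maxLetter_labels]

theorem size_ofHeights {l : List ℕ} (hl : IsHeightSeq 0 l) : (ofHeights l hl).size = l.length := by
  simp [size, ofHeights, length_labels]

theorem ofHeights_map_append {B S : List ℕ} (hB : IsHeightSeq 0 B) (hS : IsHeightSeq 0 S) :
    ofHeights _ (hB.map_append hS) = (ofHeights S hS).bracket (ofHeights B hB) := by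
  ext1
  simp only [bracket, numBlocks_ofHeights]
  simp [ofHeights, hB.labels_map_append hS, List.map_reverse]

/-- Final height `1` makes the last letter `1`, whereas `σ[τ]` with nonempty parts ends with a
letter larger than `1`. -/
theorem connected_ofHeights {B : List ℕ} (hB : IsHeightSeq 0 B) (h1 : topHeight 0 B = 1) :
    (ofHeights B hB).Connected := by
  rintro ⟨σ, τ, hσ, hτ, h⟩
  rcases B with _ | ⟨x, B⟩
  · simp at h1
  · obtain rfl : x = 1 := h1
    have hw := congrArg (fun π => π.word.reverse) h
    simp only [ofHeights, labels_cons, hB.label_one le_rfl, bracket, List.reverse_reverse,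
      List.reverse_append] at hw
    have hσ' : 1 ≤ σ.numBlocks := by
      rw [numBlocks_eq_maxLetter]
      obtain ⟨a, ha⟩ := List.exists_mem_of_ne_nil σ.word fun h => hσ (SetPartition.ext h)
      have := (σ.canonical.mem_iff a).mp ha
      omega
    rcases τ.word.eq_nil_or_concat with h0 | ⟨u, a, hu⟩
    · exact hτ (SetPartition.ext h0)
    · have ha := ((τ.canonical.mem_iff a).mp (by simp [hu])).1
      simp [hu] at hw
      omega

/-- Peel off the last component with `exists_component`; each such block contributes one to the
final height. -/
theorem length_components_ofHeights {l : List ℕ} (hl : IsHeightSeq 0 l) :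
    (ofHeights l hl).components.length = topHeight 0 l := by
  suffices h : ∃ L, (ofHeights l hl).IsComponents L ∧ L.length = topHeight 0 l by
    obtain ⟨L, h1, h2⟩ := h
    rw [← isComponents_iff.mp h1, h2]
  induction hn : l.length using Nat.strong_induction_on generalizing l with
  | _ n ih =>
    rcases l with _ | ⟨x, l⟩
    · exact ⟨[], ⟨by simp, rfl⟩, rfl⟩
    · obtain ⟨B, S, he, hB, h1, hS⟩ := hl.exists_component (by rw [minHeight_zero]; exact hl.2.1)
      have hB0 : B ≠ [] := by rintro rfl; simp at h1
      have hlen := congrArg List.length he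
      have := List.length_pos_iff.mpr hB0
      simp only [List.length_append, List.length_map, hn] at hlen
      obtain ⟨L, ⟨h2, h3⟩, h4⟩ := ih S.length (by omega) hS rfl
      simp only [he]
      rw [ofHeights_map_append hB hS, topHeight_map_append, h1]
      refine ⟨L ++ [ofHeights B hB], ⟨?_, ?_⟩, ?_⟩
      · intro c hc
        rcases List.mem_append.mp hc with hc | hc
        · exact h2 c hc
        · obtain rfl := List.mem_singleton.mp hc
          refine ⟨fun h => hB0 ?_, connected_ofHeights hB h1⟩
          rw [← List.length_eq_zero_iff, ← size_ofHeights hB, h]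
          rfl
      · rw [concat_append, ← h3, concat_cons]
        exact congrArg _ (bracket_empty _).symm
      · simp [h4, add_comm]

end SetPartition

/-! # cc-equivalence in terms of height sequences -/

namespace SetPartition

theorem ofHeights_inj {l l' : List ℕ} {hl : IsHeightSeq 0 l} {hl' : IsHeightSeq 0 l'} :
    ofHeights l hl = ofHeights l' hl' ↔ l = l' := by
  refine ⟨fun h => hl.labels_injective hl' ?_, fun h => by subst h; rfl⟩
  exact List.reverse_injective (congrArg word h)

theorem avoids_ofHeights_iff {l : List ℕ} (hl : IsHeightSeq 0 l) {σ : SetPartition} :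
    (ofHeights l hl).Avoids σ ↔ ¬ Occurs σ.word.reverse (labels l) := by
  rw [Avoids, contains_iff, ofHeights, List.reverse_reverse]

theorem nonCrossing_ofHeights {l : List ℕ} (hl : IsHeightSeq 0 l) :
    (ofHeights l hl).NonCrossing :=
  nonCrossing_iff.mpr ⟨l, hl, rfl⟩

open Classical in
/-- The height sequence of a non-crossing partition. -/
noncomputable def heights (π : SetPartition) : List ℕ :=
  if h : π.NonCrossing then (nonCrossing_iff.mp h).choose else []

theorem isHeightSeq_heights (π : SetPartition) : IsHeightSeq 0 π.heights := by
  rw [heights]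
  split_ifs with h
  · exact (nonCrossing_iff.mp h).choose_spec.choose
  · exact isHeightSeq_nil 0

theorem NonCrossing.ofHeights_heights {π : SetPartition} (h : π.NonCrossing) :
    ofHeights π.heights π.isHeightSeq_heights = π := by
  simp only [heights, h, dif_pos]
  exact (nonCrossing_iff.mp h).choose_spec.choose_spec

theorem heights_ofHeights {l : List ℕ} (hl : IsHeightSeq 0 l) : (ofHeights l hl).heights = l :=
  ofHeights_inj.mp (nonCrossing_ofHeights hl).ofHeights_heights

theorem NonCrossing.length_heights {π : SetPartition} (h : π.NonCrossing) :
    π.heights.length = π.size := by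
  rw [← size_ofHeights π.isHeightSeq_heights, h.ofHeights_heights]

theorem NonCrossing.topHeight_heights {π : SetPartition} (h : π.NonCrossing) :
    topHeight 0 π.heights = π.components.length := by
  rw [← length_components_ofHeights π.isHeightSeq_heights, h.ofHeights_heights]

theorem NonCrossing.avoids_iff {π σ : SetPartition} (h : π.NonCrossing) :
    π.Avoids σ ↔ ¬ Occurs σ.word.reverse (labels π.heights) := by
  rw [← avoids_ofHeights_iff π.isHeightSeq_heights, h.ofHeights_heights]

open Classical in
/-- The action on height sequences of a map between classes of non-crossing partitions. -/
noncomputable def onHeights {ρ ρ' : SetPartition}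
    (F : {π : SetPartition // π.Avoids p1212 ∧ π.Avoids ρ} →
      {π : SetPartition // π.Avoids p1212 ∧ π.Avoids ρ'}) (l : List ℕ) : List ℕ :=
  if h : ∃ hl : IsHeightSeq 0 l, (ofHeights l hl).Avoids ρ then
    (F ⟨ofHeights l h.choose, nonCrossing_ofHeights h.choose, h.choose_spec⟩).1.heights else []

theorem converts_onHeights {ρ ρ' : SetPartition}
    {F : {π : SetPartition // π.Avoids p1212 ∧ π.Avoids ρ} →
      {π : SetPartition // π.Avoids p1212 ∧ π.Avoids ρ'}}
    {G : {π : SetPartition // π.Avoids p1212 ∧ π.Avoids ρ'} →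
      {π : SetPartition // π.Avoids p1212 ∧ π.Avoids ρ}} (hGF : Function.LeftInverse G F)
    (hF : ∀ π, (F π).1.size = π.1.size ∧ (F π).1.components.length = π.1.components.length) :
    Converts ρ.word.reverse ρ'.word.reverse (onHeights F) (onHeights G) := by
  intro l hl hav
  have h : ∃ hl : IsHeightSeq 0 l, (ofHeights l hl).Avoids ρ :=
    ⟨hl, (avoids_ofHeights_iff hl).mpr hav⟩
  obtain ⟨π, hπ⟩ : ∃ π : {π : SetPartition // π.Avoids p1212 ∧ π.Avoids ρ}, π.1 = ofHeights l hl :=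
    ⟨⟨_, nonCrossing_ofHeights hl, h.choose_spec⟩, rfl⟩
  have hnc : (F π).1.NonCrossing := (F π).2.1
  have h1 : onHeights F l = (F π).1.heights := by
    rw [onHeights, dif_pos h]
    congr 3
    exact Subtype.ext hπ.symm
  have h' : ∃ hl : IsHeightSeq 0 (F π).1.heights, (ofHeights _ hl).Avoids ρ' :=
    ⟨isHeightSeq_heights _, hnc.ofHeights_heights.symm ▸ (F π).2.2⟩
  have h2 : onHeights G (F π).1.heights = l := by
    rw [onHeights, dif_pos h']
    have : (⟨ofHeights _ h'.choose, nonCrossing_ofHeights h'.choose, h'.choose_spec⟩ :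
      {π : SetPartition // π.Avoids p1212 ∧ π.Avoids ρ'}) = F π :=
      Subtype.ext hnc.ofHeights_heights
    rw [this, hGF, hπ, heights_ofHeights]
  rw [h1, h2, hnc.length_heights, hnc.topHeight_heights, (hF π).1, (hF π).2, hπ, size_ofHeights,
    length_components_ofHeights]
  exact ⟨isHeightSeq_heights _, hnc.avoids_iff.mp (F π).2.2, rfl, rfl, rfl⟩

/-- The map between classes of non-crossing partitions given by a map of height sequences. -/
noncomputable def ofConverts {ρ ρ' : SetPartition} {f g : List ℕ → List ℕ}
    (h : Converts ρ.word.reverse ρ'.word.reverse f g)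
    (π : {π : SetPartition // π.Avoids p1212 ∧ π.Avoids ρ}) :
    {π : SetPartition // π.Avoids p1212 ∧ π.Avoids ρ'} :=
  have h1 := h π.1.heights π.1.isHeightSeq_heights
    ((NonCrossing.avoids_iff (π := π.1) π.2.1).mp π.2.2)
  ⟨ofHeights (f π.1.heights) h1.1, nonCrossing_ofHeights h1.1,
    (avoids_ofHeights_iff h1.1).mpr h1.2.1⟩

theorem leftInverse_ofConverts {ρ ρ' : SetPartition} {f g : List ℕ → List ℕ}
    (h : Converts ρ.word.reverse ρ'.word.reverse f g)
    (h' : Converts ρ'.word.reverse ρ.word.reverse g f) :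
    Function.LeftInverse (ofConverts h') (ofConverts h) := by
  rintro ⟨π, hπ, hav⟩
  have hπ : π.NonCrossing := hπ
  obtain ⟨-, -, -, -, h1⟩ := h π.heights π.isHeightSeq_heights (hπ.avoids_iff.mp hav)
  apply Subtype.ext
  simp only [ofConverts, heights_ofHeights, h1]
  exact hπ.ofHeights_heights

theorem size_ofConverts {ρ ρ' : SetPartition} {f g : List ℕ → List ℕ}
    (h : Converts ρ.word.reverse ρ'.word.reverse f g)
    (π : {π : SetPartition // π.Avoids p1212 ∧ π.Avoids ρ}) :
    (ofConverts h π).1.size = π.1.size ∧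
      (ofConverts h π).1.components.length = π.1.components.length := by
  obtain ⟨π, hπ, hav⟩ := π
  have hπ : π.NonCrossing := hπ
  obtain ⟨-, -, h1, h2, -⟩ := h π.heights π.isHeightSeq_heights (hπ.avoids_iff.mp hav)
  simp only [ofConverts, size_ofHeights, length_components_ofHeights]
  exact ⟨h1.trans hπ.length_heights, h2.trans hπ.topHeight_heights⟩

/-- `Converts` records only a left inverse, so a bijection amounts to the relation in both
directions. -/
theorem ccEquivalent_iff {ρ ρ' : SetPartition} : CCEquivalent ρ ρ' ↔
    ρ.NonCrossing ∧ ρ'.NonCrossing ∧ ∃ f g, Converts ρ.word.reverse ρ'.word.reverse f g ∧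
      Converts ρ'.word.reverse ρ.word.reverse g f := by
  refine and_congr_right fun _ => and_congr_right fun _ => ⟨?_, ?_⟩
  · rintro ⟨e, he⟩
    refine ⟨onHeights e, onHeights e.symm, converts_onHeights e.left_inv he,
      converts_onHeights e.right_inv fun π => ?_⟩
    have := he (e.symm π)
    rw [e.apply_symm_apply] at this
    exact ⟨this.1.symm, this.2.symm⟩
  · rintro ⟨f, g, hf, hg⟩
    exact ⟨⟨ofConverts hf, ofConverts hg, leftInverse_ofConverts hf hg,
      leftInverse_ofConverts hg hf⟩, size_ofConverts hf⟩

/-! ### Compatibility of cc-equivalence with the bracket on either side -/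

theorem reverse_word_bracket (σ τ : SetPartition) : (σ.bracket τ).word.reverse =
    τ.word.reverse.map (· + σ.numBlocks) ++ σ.word.reverse := by
  simp [bracket, List.map_reverse]

theorem NonCrossing.bracket {σ τ : SetPartition} (hσ : σ.NonCrossing) (hτ : τ.NonCrossing) :
    (σ.bracket τ).NonCrossing := by
  obtain ⟨S, hS, rfl⟩ := nonCrossing_iff.mp hσ
  obtain ⟨B, hB, rfl⟩ := nonCrossing_iff.mp hτ
  rw [← ofHeights_map_append hB hS]
  exact nonCrossing_ofHeights _

theorem le_numBlocks_of_mem (σ : SetPartition) : ∀ x ∈ σ.word.reverse, x ≤ σ.numBlocks := by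
  intro x hx
  rw [numBlocks_eq_maxLetter]
  exact ((σ.canonical.mem_iff x).mp (List.mem_reverse.mp hx)).2

theorem one_le_of_mem (σ : SetPartition) : ∀ x ∈ σ.word.reverse, 1 ≤ x := fun x hx =>
  ((σ.canonical.mem_iff x).mp (List.mem_reverse.mp hx)).1

theorem CCEquivalent.bracket_right {ρ ρ' : SetPartition} (h : CCEquivalent ρ ρ')
    {τ : SetPartition} (hτ : τ.NonCrossing) : CCEquivalent (ρ.bracket τ) (ρ'.bracket τ) := by
  rw [ccEquivalent_iff] at h ⊢
  obtain ⟨h1, h2, f, g, hf, hg⟩ := h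
  refine ⟨h1.bracket hτ, h2.bracket hτ, ?_⟩
  rw [reverse_word_bracket, reverse_word_bracket]
  exact ⟨_, _, hf.modify_start ρ.le_numBlocks_of_mem ρ'.le_numBlocks_of_mem τ.one_le_of_mem,
    hg.modify_start ρ'.le_numBlocks_of_mem ρ.le_numBlocks_of_mem τ.one_le_of_mem⟩

theorem CCEquivalent.bracket_left {ρ ρ' : SetPartition} (h : CCEquivalent ρ ρ')
    {σ : SetPartition} (hσ : σ.NonCrossing) : CCEquivalent (σ.bracket ρ) (σ.bracket ρ') := by
  rw [ccEquivalent_iff] at h ⊢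
  obtain ⟨h1, h2, f, g, hf, hg⟩ := h
  refine ⟨hσ.bracket h1, hσ.bracket h2, ?_⟩
  rw [reverse_word_bracket, reverse_word_bracket]
  exact ⟨_, _, hf.modify_end σ.le_numBlocks_of_mem ρ.one_le_of_mem ρ'.one_le_of_mem,
    hg.modify_end σ.le_numBlocks_of_mem ρ'.one_le_of_mem ρ.one_le_of_mem⟩

end SetPartition

theorem mainTheorem8 (σ τ ρ ρ' : SetPartition)
    (hσ : σ.NonCrossing) (hτ : τ.NonCrossing) (hρ : SetPartition.CCEquivalent ρ ρ') :
    SetPartition.CCEquivalent ((σ.bracket ρ).bracket τ) ((σ.bracket ρ').bracket τ) :=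
  (hρ.bracket_left hσ).bracket_right hτ
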